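/- Let $G$ be a compact metrizable abelian group with normalized Haar measure $\lambda$ and dual group $\Gamma$, and let $\Lambda\subset\Gamma$ be a set of characters. For a complex Banach space $E$, let $M_\Lambda(G,E)$ be the set of countably additive $E$-valued Borel measures $\mu$ of bounded variation on $G$ with $\hat\mu(\gamma)=\int_G\bar\gamma\,d\mu=0$ for all $\gamma\in\Gamma\setminus\Lambda$; let $M^\infty_\Lambda(G,E)$ be the set of those $\mu\in M_\Lambda(G,E)$ with $|\mu|\le C\lambda$ for some constant $C$, and $M_{\Lambda,ac}(G,E)$ the set of those that are absolutely continuous with respect to $\lambda$. For $p\in\{1,\infty\}$ let $L^p_\Lambda(G,E)$ be the set of $f$ in the Bochner space $L^p(G,E)$ with $\hat f(\gamma)=\int_G\bar\gamma f\,d\lambda=0$ for all $\gamma\in\Gamma\setminus\Lambda$, where $f$ is identified with the measure $A\mapsto\int_A f\,d\lambda$. The space $E$ has the type I-$\Lambda$-RNP if $M^\infty_\Lambda(G,E)=L^\infty_\Lambda(G,E)$, and the type II-$\Lambda$-RNP if $M_{\Lambda,ac}(G,E)=L^1_\Lambda(G,E)$. It has the analytic Radon-Nikodym property if every bounded analytic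 function from the open unit disc to $E$ has radial limits in norm at almost every point of the unit circle. Theorem. Let $X$ and $Y$ be complex Banach spaces, let $X$ be separable, and suppose that $L(X,Y)=K(X,Y)$, i.e. every bounded linear operator from $X$ to $Y$ is compact. Equip $K(X,Y)$ with the operator norm. (1) If $X^*$ and $Y$ have the type I-$\Lambda$-RNP, then $K(X,Y)$ has the type I-$\Lambda$-RNP. (2) If $X^*$ and $Y$ have the type II-$\Lambda$-RNP, then $K(X,Y)$ has the type II-$\Lambda$-RNP. (3) In particular, if $X^*$ and $Y$ have the analytic Radon-Nikodym property, then so does $K(X,Y)$. -/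

import Mathlib

open MeasureTheory Filter Topology
open scoped ENNReal NNReal

noncomputable section

/-- The normalized Haar measure of a compact group. -/
def normHaar (G : Type*) [CommGroup G] [TopologicalSpace G] [IsTopologicalGroup G]
    [CompactSpace G] [MeasurableSpace G] [BorelSpace G] : Measure G :=
  Measure.haarMeasure ⊤

/-- The function `x ↦ conj (γ x)` attached to a character `γ`. -/
def conjChar {G : Type*} [CommGroup G] [TopologicalSpace G] (γ : PontryaginDual G) (x : G) : ℂ :=
  starRingEnd ℂ (γ x : ℂ)

section FunctionSpaces

variable {G : Type*} [CommGroup G] [TopologicalSpace G] [IsTopologicalGroup G]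
  [CompactSpace G] [MeasurableSpace G] [BorelSpace G]
variable {E : Type*} [NormedAddCommGroup E] [NormedSpace ℂ E] [CompleteSpace E]

/-- Fourier transform of a (Bochner integrable) function: the integral of `conj γ • f` against
normalized Haar measure. -/
def fourierFun (f : G → E) (γ : PontryaginDual G) : E :=
  ∫ x, conjChar γ x • f x ∂(normHaar G)

/-- Fourier transform of a vector measure (of bounded variation): the integral of the scalar
function `conj γ` against the `E`-valued measure `μ`, for the pairing `ℂ × E → E` given by scalar
multiplication. -/
def fourierMeas (μ : VectorMeasure G E) (γ : PontryaginDual G) : E :=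
  μ.integral (conjChar γ) (ContinuousLinearMap.lsmul ℝ ℂ)

variable (E)

/-- `M_Λ(G, E)`: countably additive `E`-valued Borel measures of bounded variation whose Fourier
transform vanishes off `Λ`. -/
def MSpec (Λ : Set (PontryaginDual G)) : Set (VectorMeasure G E) :=
  {μ | μ.variation Set.univ < ∞ ∧ ∀ γ ∉ Λ, fourierMeas μ γ = 0}

/-- `M_Λ^∞(G, E)`: those `μ` in `M_Λ(G, E)` with `|μ| ≤ C λ` for some constant `C`. -/
def MSpecInfty (Λ : Set (PontryaginDual G)) : Set (VectorMeasure G E) :=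
  {μ | μ ∈ MSpec E Λ ∧ ∃ C : ℝ≥0, μ.variation ≤ C • normHaar G}

/-- `M_{Λ,ac}(G, E)`: those `μ` in `M_Λ(G, E)` which are absolutely continuous with respect to
Haar measure. -/
def MSpecAC (Λ : Set (PontryaginDual G)) : Set (VectorMeasure G E) :=
  {μ | μ ∈ MSpec E Λ ∧ ∀ A : Set G, MeasurableSet A → normHaar G A = 0 → μ A = 0}

/-- `L_Λ^p(G, E)`, seen in the space of vector measures through `f ↦ f λ`, where
`(f λ)(A) = ∫_A f dλ`. -/
def LSpec (p : ℝ≥0∞) (Λ : Set (PontryaginDual G)) : Set (VectorMeasure G E) :=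
  {μ | ∃ f : G → E, MemLp f p (normHaar G) ∧ (∀ γ ∉ Λ, fourierFun f γ = 0) ∧
    μ = (normHaar G).withDensityᵥ f}

/-- Type I-`Λ`-Radon-Nikodym property of the complex Banach space `E`. -/
def TypeIRNP (Λ : Set (PontryaginDual G)) : Prop :=
  MSpecInfty E Λ = LSpec E ∞ Λ

/-- Type II-`Λ`-Radon-Nikodym property of the complex Banach space `E`. -/
def TypeIIRNP (Λ : Set (PontryaginDual G)) : Prop :=
  MSpecAC E Λ = LSpec E 1 Λ

end FunctionSpaces

/-- The analytic Radon-Nikodym property of a complex Banach space `E`: every bounded analytic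
function from the open unit disc to `E` has radial limits (in norm) almost everywhere on the unit
circle. -/
def AnalyticRNP (E : Type*) [NormedAddCommGroup E] [NormedSpace ℂ E] [CompleteSpace E] : Prop :=
  ∀ f : ℂ → E, DifferentiableOn ℂ f (Metric.ball 0 1) →
    (∃ C : ℝ, ∀ z ∈ Metric.ball (0 : ℂ) 1, ‖f z‖ ≤ C) →
    ∀ᵐ θ : ℝ, ∃ x : E,
      Tendsto (fun r : ℝ => f ((r : ℂ) * Complex.exp ((θ : ℂ) * Complex.I))) (𝓝[<] 1) (𝓝 x)

/-- `K(X, Y)`: compact bounded operators, with the operator norm. -/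
abbrev CompactOps (X Y : Type*) [NormedAddCommGroup X] [NormedSpace ℂ X]
    [NormedAddCommGroup Y] [NormedSpace ℂ Y] : Submodule ℂ (X →L[ℂ] Y) :=
  compactOperator (RingHom.id ℂ) X Y

instance CompactOps.completeSpace (X Y : Type*) [NormedAddCommGroup X] [NormedSpace ℂ X]
    [NormedAddCommGroup Y] [NormedSpace ℂ Y] [CompleteSpace Y] :
    CompleteSpace (CompactOps X Y) :=
  IsClosed.completeSpace_coe (s := (CompactOps X Y : Set (X →L[ℂ] Y)))
    (hs := isClosed_setOfPred_isCompactOperator)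

end

/-!
The same two tests settle all three properties. Evaluating an `L(X, Y)`-valued object at vectors
`x : X` gives `Y`-valued objects, and composing it with functionals `φ` on `Y` gives `X*`-valued
ones; both operations preserve the spectral, boundedness and absolute continuity conditions. So the
hypothesis on `Y` provides, for each `x`, a density (or radial limit) `f x`, and since `X` is
separable these fit together to a single operator-valued function `T` with `T ω x = f x ω` almost
everywhere: a density in the strong operator topology (`exists_operator_valued`,
`exists_strong_limit`). The hypothesis on `X*` shows that `ω ↦ φ ∘ T ω` is strongly measurable for
the norm of `X*`, for each `φ`.

The point is that `T` itself is then strongly measurable for the operator norm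
(`aestronglyMeasurable_compactOperators`). The values of `T` almost surely map into a separable
subspace of `Y`, so one may suppose `Y` separable. The adjoint of a compact operator is continuous
from the dual unit ball `K` with its weak-star topology to `X*` with its norm, so compact operators
embed isometrically into `C(K, X*)`, and `K` is compact metrizable. Almost all `T ω` have adjoints
mapping a dense sequence of `K`, hence all of `K`, into one separable closed set `Z ⊆ X*`; and
`C(K, Z)` is separable. Therefore `T` has almost separable range, and its distances to fixed
operators are measurable because `X` is separable.

For measures this makes `T` a Bochner integrable density, the norm of `T` being dominated by the
density of the variation (`exists_density_of_operator_valued`). For a bounded analytic function,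
`T` gives boundary values which are attained in the strong operator topology only; but the function
is their Poisson integral (`eq_poissonIntegral`), and the Poisson integral of a bounded strongly
measurable function converges radially in norm at its Lebesgue points
(`ae_tendsto_poissonIntegral`).
-/

/-! ### Separability of sets of compact operators -/

section Separability

variable {X : Type*} [NormedAddCommGroup X] [NormedSpace ℂ X]
  {Y : Type*} [NormedAddCommGroup Y] [NormedSpace ℂ Y]

/-- The closed unit ball of the dual of `Y`, with the weak-star topology. -/
abbrev weakStarBall (Y : Type*) [NormedAddCommGroup Y] [NormedSpace ℂ Y] : Set (WeakDual ℂ Y) :=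
  WeakDual.toStrongDual ⁻¹' Metric.closedBall (0 : StrongDual ℂ Y) 1

instance weakStarBall.compactSpace : CompactSpace (weakStarBall Y) :=
  isCompact_iff_compactSpace.mp (WeakDual.isCompact_closedBall _ _)

instance weakStarBall.secondCountable [TopologicalSpace.SeparableSpace Y] :
    SecondCountableTopology (weakStarBall Y) := by
  have : TopologicalSpace.MetrizableSpace (weakStarBall Y) :=
    WeakDual.metrizable_of_isCompact ℂ Y _ (WeakDual.isCompact_closedBall _ _)
  let := TopologicalSpace.metrizableSpaceMetric (weakStarBall Y)
  infer_instance

instance weakStarBall.nonempty : Nonempty (weakStarBall Y) := ⟨⟨0, by simp⟩⟩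

lemma weakStarBall.norm_le (φ : weakStarBall Y) : ‖WeakDual.toStrongDual φ.1‖ ≤ 1 :=
  mem_closedBall_zero_iff.1 φ.2

/-- Schauder: the adjoint of a compact operator is weak-star to norm continuous on the dual
unit ball. -/
lemma continuous_comp_of_isCompactOperator (T : X →L[ℂ] Y) (hT : IsCompactOperator T) :
    Continuous fun φ : weakStarBall Y => (WeakDual.toStrongDual φ.1).comp T := by
  rw [continuous_iff_continuousAt]
  intro φ
  rw [ContinuousAt, Metric.tendsto_nhds]
  intro ε hε
  obtain ⟨K, hK, hTK⟩ := hT.image_closedBall_subset_compact (f := (T : X →ₗ[ℂ] Y)) 1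
  -- test functionals on a finite `ε / 6`-net of the image of the unit ball
  obtain ⟨t, -, htfin, htK⟩ := hK.finite_cover_balls (show 0 < ε / 6 by positivity)
  have hev : ∀ᶠ ψ : weakStarBall Y in 𝓝 φ, ∀ y ∈ t, ‖ψ.1 y - φ.1 y‖ < ε / 6 := by
    rw [htfin.eventually_all]
    intro y _
    have hc : Continuous fun ψ : weakStarBall Y => ψ.1 y :=
      (WeakDual.eval_continuous y).comp continuous_subtype_val
    have := Metric.tendsto_nhds.1 (hc.tendsto φ) (ε / 6) (by positivity)
    simpa [dist_eq_norm] using this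
  filter_upwards [hev] with ψ hψ
  rw [dist_eq_norm]
  refine lt_of_le_of_lt (?_ : _ ≤ ε / 2) (by linarith)
  refine ContinuousLinearMap.opNorm_le_of_unit_norm (by positivity) fun x hx => ?_
  have hTx : T x ∈ K := hTK ⟨x, by simp [hx], rfl⟩
  obtain ⟨y, hy, hxy⟩ := Set.mem_iUnion₂.1 (htK hTx)
  rw [Metric.mem_ball, dist_eq_norm] at hxy
  have h1 : ‖(WeakDual.toStrongDual ψ.1) (T x - y)‖ ≤ ε / 6 :=
    ((WeakDual.toStrongDual ψ.1).le_of_opNorm_le (weakStarBall.norm_le ψ) _).trans (by linarith)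
  have h2 : ‖(WeakDual.toStrongDual φ.1) (T x - y)‖ ≤ ε / 6 :=
    ((WeakDual.toStrongDual φ.1).le_of_opNorm_le (weakStarBall.norm_le φ) _).trans (by linarith)
  have h3 := hψ y hy
  have h4 : ((WeakDual.toStrongDual ψ.1).comp T - (WeakDual.toStrongDual φ.1).comp T) x
      = (WeakDual.toStrongDual ψ.1) (T x - y) + (ψ.1 y - φ.1 y)
        - (WeakDual.toStrongDual φ.1) (T x - y) := by
    simp
  rw [h4]
  calc _ ≤ ‖(WeakDual.toStrongDual ψ.1) (T x - y)‖ + ‖ψ.1 y - φ.1 y‖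
        + ‖(WeakDual.toStrongDual φ.1) (T x - y)‖ :=
        (norm_sub_le _ _).trans (add_le_add_left (norm_add_le _ _) _)
    _ ≤ ε / 2 := by linarith

/-- If `Y` and `Z ⊆ X*` are separable, then so is the set of compact operators whose adjoint maps
a weak-star dense sequence of the dual unit ball of `Y` into `Z`: it embeds isometrically into the
space `C(K, Z)`, where `K` is the dual unit ball with its (compact metrizable) weak-star
topology. -/
lemma isSeparable_compactOperators [TopologicalSpace.SeparableSpace Y]
    {Z : Set (StrongDual ℂ X)} (hZ : TopologicalSpace.IsSeparable Z) (hZc : IsClosed Z) :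
    TopologicalSpace.IsSeparable {T : X →L[ℂ] Y | IsCompactOperator T ∧ ∀ n,
      (WeakDual.toStrongDual (TopologicalSpace.denseSeq (weakStarBall Y) n).1).comp T ∈ Z} := by
  set S := {T : X →L[ℂ] Y | IsCompactOperator T ∧
      ∀ n, (WeakDual.toStrongDual (TopologicalSpace.denseSeq (weakStarBall Y) n).1).comp T ∈ Z}
  have hS : ∀ (T : S) (φ : weakStarBall Y), (WeakDual.toStrongDual φ.1).comp T.1 ∈ Z := by
    intro T φ
    have hcl : IsClosed ((fun φ : weakStarBall Y => (WeakDual.toStrongDual φ.1).comp T.1) ⁻¹' Z) :=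
      hZc.preimage (continuous_comp_of_isCompactOperator T.1 T.2.1)
    have hsub := Set.range_subset_iff.2 fun n => show TopologicalSpace.denseSeq (weakStarBall Y) n ∈
      (fun φ : weakStarBall Y => (WeakDual.toStrongDual φ.1).comp T.1) ⁻¹' Z from T.2.2 n
    exact closure_minimal hsub hcl (TopologicalSpace.denseRange_denseSeq (weakStarBall Y) φ)
  have : TopologicalSpace.SeparableSpace Z := hZ.separableSpace
  have : SecondCountableTopology Z := UniformSpace.secondCountable_of_separable Z
  let Φ : S → C(weakStarBall Y, Z) := fun T =>
    ⟨fun φ => ⟨_, hS T φ⟩, (continuous_comp_of_isCompactOperator T.1 T.2.1).subtype_mk _⟩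
  have hΦ : Isometry Φ := by
    refine Isometry.of_dist_eq fun T U => le_antisymm ?_ ?_
    · rw [ContinuousMap.dist_le dist_nonneg]
      intro φ
      change dist ((WeakDual.toStrongDual φ.1).comp T.1) ((WeakDual.toStrongDual φ.1).comp U.1) ≤ _
      rw [dist_eq_norm, ← ContinuousLinearMap.comp_sub]
      refine (ContinuousLinearMap.opNorm_comp_le _ _).trans ?_
      rw [Subtype.dist_eq, dist_eq_norm]
      exact mul_le_of_le_one_left (norm_nonneg _) (weakStarBall.norm_le φ)
    · rw [Subtype.dist_eq, dist_eq_norm]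
      refine ContinuousLinearMap.opNorm_le_bound _ dist_nonneg fun x => ?_
      obtain ⟨g, hg, hgx⟩ := exists_dual_vector'' ℂ ((T.1 - U.1) x)
      have h1 := ContinuousMap.dist_apply_le_dist (f := Φ T) (g := Φ U)
        (⟨StrongDual.toWeakDual g, by simpa using hg⟩ : weakStarBall Y)
      rw [Subtype.dist_eq, dist_eq_norm] at h1
      change ‖g.comp T.1 - g.comp U.1‖ ≤ _ at h1
      have h2 := ((g.comp T.1 - g.comp U.1).le_of_opNorm_le h1) x
      have h3 : (g.comp T.1 - g.comp U.1) x = g ((T.1 - U.1) x) := by simp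
      rw [h3, hgx] at h2
      simpa using h2
  have : SecondCountableTopology S := hΦ.isEmbedding.isInducing.secondCountableTopology
  exact TopologicalSpace.IsSeparable.of_subtype S

/-- A function with almost separable range is almost everywhere strongly measurable as soon as its
distances to all points are almost everywhere measurable. -/
lemma aestronglyMeasurable_of_dist {Ω E : Type*} [MeasurableSpace Ω] {ν : Measure Ω}
    [PseudoMetricSpace E] {f : Ω → E} {s : Set E} (hs : TopologicalSpace.IsSeparable s)
    (hfs : ∀ᵐ ω ∂ν, f ω ∈ s) (hd : ∀ e, AEMeasurable (fun ω => dist (f ω) e) ν) :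
    AEStronglyMeasurable f ν := by
  obtain ⟨c, hc, hsc⟩ := hs
  rcases c.eq_empty_or_nonempty with rfl | hne
  · have : ν = 0 := by
      rw [← ae_eq_bot, ← eventually_false_iff_eq_bot]
      filter_upwards [hfs] with ω hω
      simpa using hsc hω
    simp [this]
  obtain ⟨e, rfl⟩ := hc.exists_eq_range hne
  let d : ℕ → Ω → ℝ := fun j => (hd (e j)).mk _
  have hdm : ∀ j, Measurable (d j) := fun j => (hd (e j)).measurable_mk
  classical
  -- `e (k n ω)` is the first point of the sequence `e` at distance less than `1 / (n + 1)` of `f ω`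
  let p : ℕ → Ω → ℕ → Prop := fun n ω j =>
    d j ω < 1 / ((n : ℝ) + 1) ∨ ∀ i, ¬ d i ω < 1 / ((n : ℝ) + 1)
  have hp : ∀ n ω, ∃ j, p n ω j := by
    intro n ω
    by_cases h : ∃ i, d i ω < 1 / ((n : ℝ) + 1)
    · exact h.imp fun _ => Or.inl
    · exact ⟨0, Or.inr (not_exists.1 h)⟩
  let k : ℕ → Ω → ℕ := fun n ω => Nat.find (hp n ω)
  have hk : ∀ n, Measurable (k n) := by
    intro n
    refine measurable_find (hp n) fun j => ?_
    have hlt : ∀ i, MeasurableSet {ω | d i ω < 1 / ((n : ℝ) + 1)} :=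
      fun i => measurableSet_lt (hdm i) measurable_const
    have hall : MeasurableSet {ω | ∀ i, ¬ d i ω < 1 / ((n : ℝ) + 1)} := by
      rw [Set.ofPred_forall]
      exact MeasurableSet.iInter fun i => (hlt i).compl
    exact (hlt j).union hall
  refine aestronglyMeasurable_of_tendsto_ae atTop (f := fun n ω => e (k n ω)) (fun n => ?_) ?_
  · exact (StronglyMeasurable.of_discrete (f := e)).comp_measurable (hk n) |>.aestronglyMeasurable
  · filter_upwards [hfs, ae_all_iff.2 fun j => (hd (e j)).ae_eq_mk] with ω hω hdω
    rw [Metric.tendsto_atTop]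
    intro ε hε
    obtain ⟨N, hN⟩ := exists_nat_one_div_lt hε
    refine ⟨N, fun n hn => ?_⟩
    have hn' : 1 / ((n : ℝ) + 1) ≤ 1 / ((N : ℝ) + 1) := by gcongr
    have hex : ∃ i, d i ω < 1 / ((n : ℝ) + 1) := by
      obtain ⟨_, ⟨i, rfl⟩, hi⟩ := Metric.mem_closure_iff.1 (hsc hω) (1 / ((n : ℝ) + 1))
        (by positivity)
      exact ⟨i, (hdω i).symm.trans_lt hi⟩
    rcases Nat.find_spec (hp n ω) with h | h
    · rw [dist_comm]
      refine lt_of_lt_of_le ?_ (hn'.trans hN.le)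
      rw [hdω]
      exact h
    · exact absurd hex (not_exists.2 h)

/-- Strong measurability of functions with values in a space of compact operators, tested on
vectors and on functionals. -/
lemma aestronglyMeasurable_compactOperators {Ω : Type*} [MeasurableSpace Ω] {ν : Measure Ω}
    [TopologicalSpace.SeparableSpace X] {T : Ω → X →L[ℂ] Y} (hT : ∀ ω, IsCompactOperator (T ω))
    (hx : ∀ x, AEStronglyMeasurable (fun ω => T ω x) ν)
    (hφ : ∀ φ : StrongDual ℂ Y, AEStronglyMeasurable (fun ω => φ.comp (T ω)) ν) :
    AEStronglyMeasurable T ν := by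
  -- almost all `T ω` take values in a separable closed subspace `V` of `Y`
  let xs := TopologicalSpace.denseSeq X
  choose C hC hTC using fun n => (hx (xs n)).isSeparable_ae_range
  let V : Submodule ℂ Y := (Submodule.span ℂ (⋃ n, C n)).topologicalClosure
  have hVsep : TopologicalSpace.IsSeparable (V : Set Y) := by
    rw [Submodule.topologicalClosure_coe]
    exact ((TopologicalSpace.IsSeparable.iUnion hC).span (R := ℂ)).closure
  have : TopologicalSpace.SeparableSpace V := hVsep.separableSpace
  have hVc : IsClosed (V : Set Y) := Submodule.isClosed_topologicalClosure _
  have hTV : ∀ᵐ ω ∂ν, ∀ x, T ω x ∈ V := by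
    filter_upwards [ae_all_iff.2 hTC] with ω hω x
    have hcl : IsClosed ((T ω) ⁻¹' (V : Set Y)) := hVc.preimage (T ω).continuous
    refine closure_minimal (Set.range_subset_iff.2 fun n => ?_) hcl
      (TopologicalSpace.denseRange_denseSeq X x)
    exact Submodule.le_topologicalClosure _
      (Submodule.subset_span (Set.mem_iUnion_of_mem n (hω n)))
  -- the adjoints almost surely map a weak-star dense sequence into a separable subset of `X*`
  let q : ℕ → StrongDual ℂ V := fun n =>
    WeakDual.toStrongDual (TopologicalSpace.denseSeq (weakStarBall V) n).1
  choose q' hq' _ using fun n => exists_extension_norm_eq V (q n)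
  choose D hD hTD using fun n => (hφ (q' n)).isSeparable_ae_range
  let Z : Set (StrongDual ℂ X) := closure (⋃ n, D n)
  have hZ : TopologicalSpace.IsSeparable Z := (TopologicalSpace.IsSeparable.iUnion hD).closure
  have hsep := (isSeparable_compactOperators (Y := V) hZ isClosed_closure).image
    (f := fun S : X →L[ℂ] V => V.subtypeL.comp S) (by fun_prop)
  refine aestronglyMeasurable_of_dist hsep ?_ fun S => ?_
  · filter_upwards [hTV, ae_all_iff.2 hTD] with ω hω hωD
    refine ⟨(T ω).codRestrict V hω, ⟨?_, fun n => ?_⟩, by ext; rfl⟩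
    · exact (hT ω).codRestrict hω hVc
    · have : (q n).comp ((T ω).codRestrict V hω) = (q' n).comp (T ω) := by
        ext x
        exact (hq' n ⟨T ω x, hω x⟩).symm
      change (q n).comp ((T ω).codRestrict V hω) ∈ Z
      rw [this]
      exact subset_closure (Set.mem_iUnion_of_mem n (hωD n))
  · -- operator norms are suprema over a dense sequence (with `0 / 0 = 0` if it contains `0`)
    have hnorm : ∀ U : X →L[ℂ] Y, ‖U‖ₑ = ⨆ n, ‖U (xs n)‖ₑ / ‖xs n‖ₑ := by
      intro U
      refine le_antisymm ?_ (iSup_le fun n => ENNReal.div_le_of_le_mul (U.le_opENorm _))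
      set M := ⨆ n, ‖U (xs n)‖ₑ / ‖xs n‖ₑ with hM
      have hMtop : M ≠ ∞ := ne_top_of_le_ne_top (enorm_ne_top (x := U))
        (iSup_le fun n => ENNReal.div_le_of_le_mul (U.le_opENorm _))
      refine ContinuousLinearMap.opENorm_le_bound _ fun x => ?_
      have hcl : IsClosed {x | ‖U x‖ₑ ≤ M * ‖x‖ₑ} :=
        isClosed_le (by fun_prop) ((ENNReal.continuous_const_mul hMtop).comp continuous_enorm)
      refine closure_minimal (Set.range_subset_iff.2 fun n => ?_) hcl
        (TopologicalSpace.denseRange_denseSeq X x)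
      exact (ENNReal.div_le_iff_le_mul (.inr hMtop) (.inl enorm_ne_top)).1
        (le_iSup (fun n => ‖U (xs n)‖ₑ / ‖xs n‖ₑ) n)
    have : AEMeasurable (fun ω => ‖T ω - S‖ₑ) ν := by
      simp_rw [hnorm]
      refine AEMeasurable.iSup fun n => ?_
      exact (((hx (xs n)).sub aestronglyMeasurable_const).enorm).div_const _
    simpa [dist_eq_norm] using this.ennreal_toReal

end Separability

/-! ### Fourier transforms of vector measures -/

section VectorMeasures

/-- A property of complex functions which holds for indicators and is stable under sums and bounded
pointwise limits of sequences of simple functions holds for all bounded strongly measurable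
functions. -/
lemma bounded_induction {α : Type*} [MeasurableSpace α] {P : (α → ℂ) → Prop}
    (hind : ∀ (c : ℂ) (s : Set α), MeasurableSet s → P (s.indicator fun _ => c))
    (hadd : ∀ f g : SimpleFunc α ℂ, P f → P g → P (f + g))
    (hlim : ∀ (F : ℕ → SimpleFunc α ℂ) (f : α → ℂ) (C : ℝ), (∀ n x, ‖F n x‖ ≤ C) →
      (∀ x, Tendsto (fun n => F n x) atTop (𝓝 (f x))) → (∀ n, P (F n)) → P f)
    {f : α → ℂ} (hf : StronglyMeasurable f) {C : ℝ} (hC : 0 ≤ C) (hfC : ∀ x, ‖f x‖ ≤ C) : P f := by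
  refine hlim (hf.approxBounded C) f C (fun n x => hf.norm_approxBounded_le hC n x)
    (fun x => hf.tendsto_approxBounded_of_norm_le (hfC x)) fun n => ?_
  refine SimpleFunc.induction (motive := fun g => P g) (fun c s hs => ?_) (fun f g _ hf hg => ?_) _
  · simpa using! hind c s hs
  · exact hadd f g hf hg

variable {α : Type*} [MeasurableSpace α]
  {E : Type*} [NormedAddCommGroup E] [NormedSpace ℂ E]
  {F : Type*} [NormedAddCommGroup F] [NormedSpace ℂ F]

/-- The image of a vector measure under a bounded linear operator. -/
noncomputable def clmMap (T : E →L[ℂ] F) (μ : VectorMeasure α E) : VectorMeasure α F :=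
  μ.mapRange (T : E →+ F) T.continuous

@[simp] lemma clmMap_apply (T : E →L[ℂ] F) (μ : VectorMeasure α E) (s : Set α) :
    clmMap T μ s = T (μ s) := rfl

lemma variation_clmMap_le (T : E →L[ℂ] F) (μ : VectorMeasure α E) :
    (clmMap T μ).variation ≤ ‖T‖₊ • μ.variation := by
  refine VectorMeasure.variation_le_of_forall_enorm_le fun s _ => ?_
  rw [clmMap_apply, Measure.smul_apply, ENNReal.smul_def, smul_eq_mul, ← enorm_eq_nnnorm]
  exact (T.le_opENorm _).trans (by gcongr; exact VectorMeasure.enorm_measure_le_variation _ _)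

lemma integral_indicator_const [CompleteSpace E] (μ : VectorMeasure α E)
    [IsFiniteMeasure μ.variation] (c : ℂ) {s : Set α} (hs : MeasurableSet s) :
    μ.integral (s.indicator fun _ => c) (ContinuousLinearMap.lsmul ℝ ℂ) = c • μ s := by
  rw [VectorMeasure.integral_indicator hs, VectorMeasure.setIntegral_const]
  rfl

omit [NormedSpace ℂ E] in
lemma integrable_simpleFunc_vectorMeasure (μ : VectorMeasure α E) [IsFiniteMeasure μ.variation]
    (f : SimpleFunc α ℂ) : μ.Integrable f :=
  SimpleFunc.integrable_of_isFiniteMeasure f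

lemma tendsto_integral_simpleFunc (μ : VectorMeasure α E) [IsFiniteMeasure μ.variation]
    {G : ℕ → SimpleFunc α ℂ} {g : α → ℂ} {C : ℝ} (hC : ∀ n x, ‖G n x‖ ≤ C)
    (hG : ∀ x, Tendsto (fun n => G n x) atTop (𝓝 (g x))) :
    Tendsto (fun n => μ.integral (G n) (ContinuousLinearMap.lsmul ℝ ℂ)) atTop
      (𝓝 (μ.integral g (ContinuousLinearMap.lsmul ℝ ℂ))) :=
  VectorMeasure.tendsto_integral_filter_of_norm_le_const
    (.of_forall fun n => (G n).stronglyMeasurable.aestronglyMeasurable)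
    ⟨C, .of_forall fun n => .of_forall (hC n)⟩ (.of_forall hG)

/-- Bounded operators commute with integrals of bounded functions against vector measures of
bounded variation. -/
lemma integral_clmMap [CompleteSpace E] [CompleteSpace F] (T : E →L[ℂ] F) (μ : VectorMeasure α E)
    [IsFiniteMeasure μ.variation] {g : α → ℂ} (hg : StronglyMeasurable g) {C : ℝ} (hC : 0 ≤ C)
    (hgC : ∀ x, ‖g x‖ ≤ C) :
    (clmMap T μ).integral g (ContinuousLinearMap.lsmul ℝ ℂ)
      = T (μ.integral g (ContinuousLinearMap.lsmul ℝ ℂ)) := by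
  have : IsFiniteMeasure (clmMap T μ).variation := isFiniteMeasure_of_le _ (variation_clmMap_le T μ)
  refine bounded_induction (P := fun g => (clmMap T μ).integral g (ContinuousLinearMap.lsmul ℝ ℂ)
      = T (μ.integral g (ContinuousLinearMap.lsmul ℝ ℂ))) (fun c s hs => ?_) (fun f g hf hg => ?_)
    (fun G g C hC hG hP => ?_) hg hC hgC
  · rw [integral_indicator_const _ _ hs, integral_indicator_const _ _ hs, clmMap_apply, map_smul]
  · rw [VectorMeasure.integral_add (integrable_simpleFunc_vectorMeasure _ f)
      (integrable_simpleFunc_vectorMeasure _ g), VectorMeasure.integral_add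
      (integrable_simpleFunc_vectorMeasure _ f) (integrable_simpleFunc_vectorMeasure _ g),
      map_add, hf, hg]
  · refine tendsto_nhds_unique (tendsto_integral_simpleFunc (clmMap T μ) hC hG) ?_
    simp_rw [hP]
    exact (T.continuous.tendsto _).comp (tendsto_integral_simpleFunc μ hC hG)

lemma isFiniteMeasure_variation_withDensityᵥ [CompleteSpace E] {ν : Measure α} {f : α → E}
    (hf : Integrable f ν) : IsFiniteMeasure (ν.withDensityᵥ f).variation := by
  rw [Measure.variation_withDensityᵥ hf]
  exact ⟨by simpa using! hf.2⟩

/-- Integrating a bounded function against the vector measure with density `f` amounts to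
integrating its product with `f`. -/
lemma integral_withDensityᵥ [CompleteSpace E] {ν : Measure α} {f : α → E}
    (hf : Integrable f ν) {g : α → ℂ} (hg : StronglyMeasurable g) {C : ℝ} (hC : 0 ≤ C)
    (hgC : ∀ x, ‖g x‖ ≤ C) :
    (ν.withDensityᵥ f).integral g (ContinuousLinearMap.lsmul ℝ ℂ) = ∫ x, g x • f x ∂ν := by
  have := isFiniteMeasure_variation_withDensityᵥ hf
  have hint : ∀ g : SimpleFunc α ℂ, Integrable (fun x => g x • f x) ν := by
    intro g
    obtain ⟨C, hC⟩ := g.exists_forall_norm_le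
    exact hf.bdd_smul C g.stronglyMeasurable.aestronglyMeasurable (.of_forall hC)
  refine bounded_induction (P := fun g => (ν.withDensityᵥ f).integral g
    (ContinuousLinearMap.lsmul ℝ ℂ) = ∫ x, g x • f x ∂ν) (fun c s hs => ?_) (fun g h hg hh => ?_)
    (fun G g C hC hG hP => ?_) hg hC hgC
  · rw [integral_indicator_const _ _ hs, withDensityᵥ_apply hf hs, ← integral_smul,
      ← MeasureTheory.integral_indicator hs]
    congr 1 with x
    by_cases hx : x ∈ s <;> simp [hx]
  · rw [VectorMeasure.integral_add (integrable_simpleFunc_vectorMeasure _ g)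
      (integrable_simpleFunc_vectorMeasure _ h), hg, hh,
      ← MeasureTheory.integral_add (hint g) (hint h)]
    simp [add_smul]
  · refine tendsto_nhds_unique (tendsto_integral_simpleFunc _ hC hG) ?_
    simp_rw [hP]
    refine MeasureTheory.tendsto_integral_of_dominated_convergence (fun x => C * ‖f x‖)
      (fun n => (hint _).aestronglyMeasurable) (hf.norm.const_mul C)
      (fun n => .of_forall fun x => ?_)
      (.of_forall fun x => (hG x).smul_const _)
    rw [norm_smul]
    gcongr
    exact hC n x

end VectorMeasures

section FourierTransforms

variable {G : Type*} [CommGroup G] [TopologicalSpace G] [IsTopologicalGroup G]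
  [CompactSpace G] [MeasurableSpace G] [BorelSpace G]
  {E : Type*} [NormedAddCommGroup E] [NormedSpace ℂ E] [CompleteSpace E]
  {F : Type*} [NormedAddCommGroup F] [NormedSpace ℂ F] [CompleteSpace F]

instance normHaar.isFiniteMeasure : IsFiniteMeasure (normHaar G) := by
  unfold normHaar; infer_instance

omit [IsTopologicalGroup G] [CompactSpace G] in
lemma stronglyMeasurable_conjChar (γ : PontryaginDual G) : StronglyMeasurable (conjChar γ) := by
  have : Continuous (conjChar γ) :=
    Complex.continuous_conj.comp (continuous_subtype_val.comp (map_continuous γ))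
  exact this.measurable.stronglyMeasurable

omit [IsTopologicalGroup G] [CompactSpace G] [MeasurableSpace G] [BorelSpace G] in
lemma norm_conjChar_le (γ : PontryaginDual G) (x : G) : ‖conjChar γ x‖ ≤ 1 := by
  simp [conjChar, Circle.norm_coe]

omit [IsTopologicalGroup G] [CompactSpace G] in
lemma fourierMeas_clmMap (T : E →L[ℂ] F) (μ : VectorMeasure G E) [IsFiniteMeasure μ.variation]
    (γ : PontryaginDual G) : fourierMeas (clmMap T μ) γ = T (fourierMeas μ γ) :=
  integral_clmMap T μ (stronglyMeasurable_conjChar γ) zero_le_one (norm_conjChar_le γ)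

lemma fourierMeas_withDensityᵥ {f : G → E} (hf : Integrable f (normHaar G))
    (γ : PontryaginDual G) : fourierMeas ((normHaar G).withDensityᵥ f) γ = fourierFun f γ :=
  integral_withDensityᵥ hf (stronglyMeasurable_conjChar γ) zero_le_one (norm_conjChar_le γ)

omit [IsTopologicalGroup G] [CompactSpace G] in
lemma clmMap_mem_MSpec {Λ : Set (PontryaginDual G)} {μ : VectorMeasure G E} (hμ : μ ∈ MSpec E Λ)
    (T : E →L[ℂ] F) : clmMap T μ ∈ MSpec F Λ := by
  have : IsFiniteMeasure μ.variation := ⟨hμ.1⟩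
  refine ⟨(isFiniteMeasure_of_le _ (variation_clmMap_le T μ)).measure_univ_lt_top, fun γ hγ => ?_⟩
  rw [fourierMeas_clmMap, hμ.2 γ hγ, map_zero]

lemma clmMap_mem_MSpecAC {Λ : Set (PontryaginDual G)} {μ : VectorMeasure G E}
    (hμ : μ ∈ MSpecAC E Λ) (T : E →L[ℂ] F) : clmMap T μ ∈ MSpecAC F Λ :=
  ⟨clmMap_mem_MSpec hμ.1 T, fun A hA h => by rw [clmMap_apply, hμ.2 A hA h, map_zero]⟩

lemma clmMap_mem_MSpecInfty {Λ : Set (PontryaginDual G)} {μ : VectorMeasure G E}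
    (hμ : μ ∈ MSpecInfty E Λ) (T : E →L[ℂ] F) : clmMap T μ ∈ MSpecInfty F Λ := by
  obtain ⟨C, hC⟩ := hμ.2
  refine ⟨clmMap_mem_MSpec hμ.1 T, ‖T‖₊ * C, (variation_clmMap_le T μ).trans ?_⟩
  rw [mul_smul]
  gcongr

lemma withDensityᵥ_mem_MSpec {Λ : Set (PontryaginDual G)} {f : G → E}
    (hf : Integrable f (normHaar G)) (hΛ : ∀ γ ∉ Λ, fourierFun f γ = 0) :
    (normHaar G).withDensityᵥ f ∈ MSpec E Λ :=
  ⟨(isFiniteMeasure_variation_withDensityᵥ hf).measure_univ_lt_top,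
    fun γ hγ => by rw [fourierMeas_withDensityᵥ hf, hΛ γ hγ]⟩

lemma LSpec_one_subset (Λ : Set (PontryaginDual G)) : LSpec E 1 Λ ⊆ MSpecAC E Λ := by
  rintro _ ⟨f, hf, hΛ, rfl⟩
  have hf' := memLp_one_iff_integrable.1 hf
  refine ⟨withDensityᵥ_mem_MSpec hf' hΛ, fun A hA h => ?_⟩
  rw [withDensityᵥ_apply hf' hA, Measure.restrict_eq_zero.2 h, integral_zero_measure]

lemma LSpec_top_subset (Λ : Set (PontryaginDual G)) : LSpec E ∞ Λ ⊆ MSpecInfty E Λ := by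
  rintro _ ⟨f, hf, hΛ, rfl⟩
  have hf' : Integrable f (normHaar G) := hf.integrable le_top
  refine ⟨withDensityᵥ_mem_MSpec hf' hΛ, (eLpNorm f ∞ (normHaar G)).toNNReal, ?_⟩
  have hfin : eLpNorm f ∞ (normHaar G) ≠ ∞ := hf.2.ne
  rw [Measure.variation_withDensityᵥ hf']
  calc (normHaar G).withDensity (fun x => ‖f x‖ₑ)
      ≤ (normHaar G).withDensity (fun _ => ((eLpNorm f ∞ (normHaar G)).toNNReal : ℝ≥0∞)) := by
        refine withDensity_mono ?_
        rw [ENNReal.coe_toNNReal hfin, eLpNorm_exponent_top]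
        exact enorm_ae_le_eLpNormEssSup f _
    _ = (eLpNorm f ∞ (normHaar G)).toNNReal • normHaar G := withDensity_const _

omit [CompleteSpace E] in
lemma MSpecInfty_subset_MSpecAC (Λ : Set (PontryaginDual G)) : MSpecInfty E Λ ⊆ MSpecAC E Λ := by
  rintro μ ⟨hμ, C, hC⟩
  refine ⟨hμ, fun A _ h => ?_⟩
  have h1 : μ.variation A = 0 := le_antisymm ((hC A).trans (by simp [h])) zero_le
  have h2 := μ.enorm_measure_le_variation A
  rw [h1] at h2
  simpa using h2

omit [CompleteSpace E] in
/-- The variation of a measure of bounded variation which vanishes on null sets has an integrable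
density. -/
lemma variation_eq_withDensity {Λ : Set (PontryaginDual G)} {μ : VectorMeasure G E}
    (hμ : μ ∈ MSpecAC E Λ) :
    ∃ h : G → ℝ≥0∞, Measurable h ∧ ∫⁻ x, h x ∂(normHaar G) < ∞ ∧
      μ.variation = (normHaar G).withDensity h := by
  have : IsFiniteMeasure μ.variation := ⟨hμ.1.1⟩
  have hac : μ.variation ≪ normHaar G := by
    refine Measure.AbsolutelyContinuous.mk fun A hA h => ?_
    rw [VectorMeasure.variation_apply_eq_zero hA]
    exact fun t ht htm => hμ.2 t htm (measure_mono_null ht h)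
  exact ⟨_, Measure.measurable_rnDeriv _ _, Measure.lintegral_rnDeriv_lt_top _ _,
    (Measure.withDensity_rnDeriv_eq _ _ hac).symm⟩

end FourierTransforms

/-! ### Operator-valued densities -/

section OperatorDensities

variable {X : Type*} [NormedAddCommGroup X] [NormedSpace ℂ X]
  {Y : Type*} [NormedAddCommGroup Y] [NormedSpace ℂ Y] [CompleteSpace Y]

/-- A bounded additive function on a dense subgroup extends to a bounded operator, which is complex
linear if the function commutes with multiplication by `I` on a dense sequence of the subgroup. -/
lemma exists_clm_extension {A : Submodule ℤ X} {d : ℕ → X} (hd : DenseRange d)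
    (hdA : ∀ n, d n ∈ A) (hIdA : ∀ n, Complex.I • d n ∈ A) {φ : X → Y} {c : ℝ} (hc : 0 ≤ c)
    (hadd : ∀ a ∈ A, ∀ b ∈ A, φ (a + b) = φ a + φ b)
    (hI : ∀ n, φ (Complex.I • d n) = Complex.I • φ (d n))
    (hb : ∀ a ∈ A, ‖φ a‖ ≤ c * ‖a‖) :
    ∃ T : X →L[ℂ] Y, (∀ a ∈ A, T a = φ a) ∧ ‖T‖ ≤ c := by
  let φA : A →+ Y := AddMonoidHom.mk' (fun a => φ a) fun a b => hadd a a.2 b b.2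
  have hcont : Continuous φA := AddMonoidHomClass.continuous_of_bound φA c fun a => hb a a.2
  let φL : A →L[ℤ] Y := ⟨φA.toIntLinearMap, hcont⟩
  let e : A →L[ℤ] X := A.subtypeL
  have hdense : DenseRange e := hd.mono (Set.range_subset_iff.2 fun n => ⟨⟨d n, hdA n⟩, rfl⟩)
  have he : IsUniformInducing e := isUniformEmbedding_subtype_val.isUniformInducing
  let T₀ : X →L[ℤ] Y := φL.extend e
  have hT₀ : ∀ a ∈ A, T₀ a = φ a := fun a ha => φL.extend_eq hdense he ⟨a, ha⟩
  let T₁ : X →L[ℝ] Y := T₀.toLinearMap.toAddMonoidHom.toRealLinearMap T₀.continuous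
  have hT₁ : ∀ a ∈ A, T₁ a = φ a := hT₀
  have hTI : ∀ x, T₁ (Complex.I • x) = Complex.I • T₁ x := by
    intro x
    refine hd.induction_on (p := fun x => T₁ (Complex.I • x) = Complex.I • T₁ x) x
      (isClosed_eq (by fun_prop) (by fun_prop)) fun n => ?_
    rw [hT₁ _ (hIdA n), hT₁ _ (hdA n), hI]
  let T : X →L[ℂ] Y :=
    { toFun := T₁
      map_add' := map_add T₁
      map_smul' := fun z x => by
        have hre : ∀ (r : ℝ) (w : X), T₁ ((r : ℂ) • w) = (r : ℂ) • T₁ w := fun r w => by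
          rw [Complex.coe_smul, Complex.coe_smul, map_smul]
        rw [← Complex.re_add_im z, add_smul, map_add, mul_smul, hre, hre, hTI, RingHom.id_apply,
          add_smul, mul_smul]
      cont := T₁.continuous }
  refine ⟨T, hT₁, T.opNorm_le_bound hc fun x => ?_⟩
  refine hd.induction_on (p := fun x => ‖T x‖ ≤ c * ‖x‖) x
    (isClosed_le (by fun_prop) (by fun_prop)) fun n => ?_
  have : T (d n) = φ (d n) := hT₁ _ (hdA n)
  rw [this]
  exact hb _ (hdA n)

/-- A family of functions depending almost surely linearly and boundedly on a vector `x` of a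
separable space comes from a single operator-valued function. -/
lemma exists_operator_valued {Ω : Type*} [MeasurableSpace Ω] {ν : Measure Ω}
    [TopologicalSpace.SeparableSpace X] {f : X → Ω → Y} {h : Ω → ℝ≥0∞} (hfin : ∀ᵐ ω ∂ν, h ω < ∞)
    (hadd : ∀ x x', ∀ᵐ ω ∂ν, f (x + x') ω = f x ω + f x' ω)
    (hI : ∀ x, ∀ᵐ ω ∂ν, f (Complex.I • x) ω = Complex.I • f x ω)
    (hb : ∀ x, ∀ᵐ ω ∂ν, ‖f x ω‖ₑ ≤ ‖x‖ₑ * h ω) :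
    ∃ T : Ω → X →L[ℂ] Y, (∀ x, ∀ᵐ ω ∂ν, T ω x = f x ω) ∧ ∀ᵐ ω ∂ν, ‖T ω‖ₑ ≤ h ω := by
  -- a countable dense subgroup on which additivity and boundedness hold almost surely, all at once
  let d := TopologicalSpace.denseSeq X
  have hd : DenseRange d := TopologicalSpace.denseRange_denseSeq X
  let v : ℕ ⊕ ℕ → X := Sum.elim d fun n => Complex.I • d n
  let A := Submodule.span ℤ (Set.range v)
  have hA : Countable A := by
    change Countable (Submodule.span ℤ (Set.range v))
    rw [← Finsupp.range_linearCombination]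
    exact (Set.countable_range (Finsupp.linearCombination ℤ v)).to_subtype
  have hdA : ∀ n, d n ∈ A := fun n => Submodule.subset_span ⟨.inl n, rfl⟩
  have hIdA : ∀ n, Complex.I • d n ∈ A := fun n => Submodule.subset_span ⟨.inr n, rfl⟩
  have hreal : ∀ {y : Y} {x : X} {c : ℝ≥0∞}, c < ∞ → ‖y‖ₑ ≤ ‖x‖ₑ * c → ‖y‖ ≤ c.toReal * ‖x‖ := by
    intro y x c hc hle
    have := ENNReal.toReal_mono (ENNReal.mul_ne_top enorm_ne_top hc.ne) hle
    simpa [mul_comm] using this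
  have key : ∀ᵐ ω ∂ν, ∃ T : X →L[ℂ] Y, (∀ a ∈ A, T a = f a ω) ∧ ‖T‖ ≤ (h ω).toReal := by
    have h1 : ∀ᵐ ω ∂ν, ∀ a b : A, f (a + b) ω = f a ω + f b ω :=
      ae_all_iff.2 fun a => ae_all_iff.2 fun b => hadd a b
    have h2 : ∀ᵐ ω ∂ν, ∀ a : A, ‖f a ω‖ₑ ≤ ‖(a : X)‖ₑ * h ω := ae_all_iff.2 fun a => hb a
    filter_upwards [h1, h2, ae_all_iff.2 fun n => hI (d n), hfin] with ω h1 h2 h3 h4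
    exact exists_clm_extension (φ := fun x => f x ω) hd hdA hIdA ENNReal.toReal_nonneg
      (fun a ha b hb => h1 ⟨a, ha⟩ ⟨b, hb⟩) h3 fun a ha => hreal h4 (h2 ⟨a, ha⟩)
  classical
  refine ⟨fun ω => if H : _ then Classical.choose (p := fun T : X →L[ℂ] Y =>
    (∀ a ∈ A, T a = f a ω) ∧ ‖T‖ ≤ (h ω).toReal) H else 0, fun x => ?_, ?_⟩
  swap
  · filter_upwards [key, hfin] with ω H h4
    rw [dif_pos H, ← ofReal_norm]
    exact ENNReal.ofReal_le_of_le_toReal (Classical.choose_spec H).2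
  filter_upwards [key, hfin, ae_all_iff.2 fun n => hadd (x - d n) (d n),
    ae_all_iff.2 fun n => hb (x - d n)] with ω H h4 h1 h2
  rw [dif_pos H]
  obtain ⟨hT, hTn⟩ := Classical.choose_spec H
  set T := Classical.choose H
  set c := (h ω).toReal
  have hcl : IsClosed {y : X | ‖T x - f x ω‖ ≤ (c + c) * ‖x - y‖} :=
    isClosed_le continuous_const (by fun_prop)
  have hx := closure_minimal (Set.range_subset_iff.2 fun n => ?_) hcl (hd x)
  · rw [Set.mem_ofPred_eq, sub_self, norm_zero, mul_zero] at hx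
    exact sub_eq_zero.1 (norm_le_zero_iff.1 hx)
  · have e1 := hreal h4 (h2 n)
    have e2 : f x ω = f (x - d n) ω + T (d n) := by
      rw [hT _ (hdA n), ← h1 n, sub_add_cancel]
    have e3 := T.le_of_opNorm_le hTn (x - d n)
    change ‖T x - f x ω‖ ≤ _
    rw [e2, ← sub_sub, sub_right_comm, ← map_sub, add_mul]
    exact (norm_sub_le _ _).trans (add_le_add e3 e1)

end OperatorDensities

section RadonNikodym

lemma ae_le_of_withDensity_le {α : Type*} [MeasurableSpace α] {ν : Measure α} [SigmaFinite ν]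
    {f g : α → ℝ≥0∞} (hf : AEMeasurable f ν) (h : ν.withDensity f ≤ ν.withDensity g) :
    f ≤ᵐ[ν] g := by
  refine ae_le_of_forall_setLIntegral_le_of_sigmaFinite₀ hf fun s hs _ => ?_
  rw [← withDensity_apply _ hs, ← withDensity_apply _ hs]
  exact h s

variable {G : Type*} [CommGroup G] [TopologicalSpace G] [IsTopologicalGroup G]
  [CompactSpace G] [MeasurableSpace G] [BorelSpace G]
  {X : Type*} [NormedAddCommGroup X] [NormedSpace ℂ X]
  {Y : Type*} [NormedAddCommGroup Y] [NormedSpace ℂ Y] [CompleteSpace Y]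
  {E : Type*} [NormedAddCommGroup E] [NormedSpace ℂ E] [CompleteSpace E]

/-- If all operators from `X` to `Y` are compact and `X` is separable, then a measure with values in
`E ≃ L(X, Y)` has a Bochner integrable density as soon as its evaluations at vectors of `X` and its
compositions with functionals on `Y` have Bochner integrable densities. -/
lemma exists_density_of_operator_valued [TopologicalSpace.SeparableSpace X]
    (hc : ∀ T : X →L[ℂ] Y, IsCompactOperator T) (e : E ≃ₗᵢ[ℂ] (X →L[ℂ] Y))
    {Λ : Set (PontryaginDual G)} {μ : VectorMeasure G E} (hμ : μ ∈ MSpecAC E Λ)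
    (hY : ∀ L : E →L[ℂ] Y, ∃ f : G → Y, Integrable f (normHaar G) ∧
      clmMap L μ = (normHaar G).withDensityᵥ f)
    (hX : ∀ L : E →L[ℂ] StrongDual ℂ X, ∃ g : G → StrongDual ℂ X, Integrable g (normHaar G) ∧
      clmMap L μ = (normHaar G).withDensityᵥ g) :
    ∃ F : G → E, Integrable F (normHaar G) ∧ μ = (normHaar G).withDensityᵥ F := by
  obtain ⟨h, hhm, hhfin, hvar⟩ := variation_eq_withDensity hμ
  let eC : E →L[ℂ] (X →L[ℂ] Y) := e.toLinearIsometry.toContinuousLinearMap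
  let ev : X → E →L[ℂ] Y := fun x => (ContinuousLinearMap.apply ℂ Y x).comp eC
  let ad : StrongDual ℂ Y → E →L[ℂ] StrongDual ℂ X := fun φ =>
    (ContinuousLinearMap.compL ℂ X Y ℂ φ).comp eC
  choose f hf hμf using fun x => hY (ev x)
  choose g hg hμg using fun φ => hX (ad φ)
  have hfs : ∀ x s, MeasurableSet s → ∫ ω in s, f x ω ∂(normHaar G) = e (μ s) x := fun x s hs => by
    rw [← withDensityᵥ_apply (hf x) hs, ← hμf]; rfl
  have hgs : ∀ φ s, MeasurableSet s → ∫ ω in s, g φ ω ∂(normHaar G) = φ.comp (e (μ s)) :=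
    fun φ s hs => by rw [← withDensityᵥ_apply (hg φ) hs, ← hμg]; rfl
  -- the density of `μ` in the strong operator topology
  obtain ⟨T, hT, hTb⟩ : ∃ T : G → X →L[ℂ] Y, (∀ x, ∀ᵐ ω ∂(normHaar G), T ω x = f x ω) ∧
      ∀ᵐ ω ∂(normHaar G), ‖T ω‖ₑ ≤ h ω := by
    refine exists_operator_valued (h := h) (ae_lt_top hhm hhfin.ne) (fun x x' => ?_) (fun x => ?_)
      fun x => ?_
    · refine (hf (x + x')).ae_eq_of_forall_setIntegral_eq _ _ ((hf x).add (hf x')) fun s hs _ => ?_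
      rw [integral_add (hf x).integrableOn (hf x').integrableOn, hfs _ _ hs, hfs _ _ hs, hfs _ _ hs,
        map_add]
    · refine (hf (Complex.I • x)).ae_eq_of_forall_setIntegral_eq _ _ ((hf x).smul Complex.I)
        fun s hs _ => ?_
      rw [integral_smul, hfs _ _ hs, hfs _ _ hs, map_smul]
    · refine ae_le_of_withDensity_le (hf x).aestronglyMeasurable.enorm ?_
      rw [← Measure.variation_withDensityᵥ (hf x), ← hμf]
      refine VectorMeasure.variation_le_of_forall_enorm_le fun s hs => ?_
      rw [withDensity_apply _ hs, lintegral_const_mul _ hhm, ← withDensity_apply _ hs, ← hvar]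
      calc ‖e (μ s) x‖ₑ ≤ ‖e (μ s)‖ₑ * ‖x‖ₑ := ContinuousLinearMap.le_opENorm _ _
        _ = ‖x‖ₑ * ‖μ s‖ₑ := by
          rw [mul_comm, enorm_eq_nnnorm (e (μ s)), e.nnnorm_map, enorm_eq_nnnorm (μ s)]
        _ ≤ _ := by gcongr; exact VectorMeasure.enorm_measure_le_variation _ _
  -- the adjoints of the operators `T ω` are given by the densities of the compositions
  have hTg : ∀ φ : StrongDual ℂ Y, (fun ω => φ.comp (T ω)) =ᵐ[normHaar G] g φ := by
    intro φ
    have hpt : ∀ x, ∀ᵐ ω ∂(normHaar G), φ (f x ω) = g φ ω x := by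
      intro x
      have hgx := (ContinuousLinearMap.apply ℂ ℂ x).integrable_comp (hg φ)
      refine (φ.integrable_comp (hf x)).ae_eq_of_forall_setIntegral_eq _ _ hgx fun s hs _ => ?_
      rw [φ.integral_comp_comm (hf x).integrableOn, hfs _ _ hs]
      exact (congrArg (fun S : StrongDual ℂ X => S x) (hgs φ s hs)).symm.trans
        ((ContinuousLinearMap.apply ℂ ℂ x).integral_comp_comm (hg φ).integrableOn).symm
    filter_upwards [ae_all_iff.2 fun n => hpt (TopologicalSpace.denseSeq X n),
      ae_all_iff.2 fun n => hT (TopologicalSpace.denseSeq X n)] with ω h1 h2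
    refine ContinuousLinearMap.coeFn_injective ?_
    refine (TopologicalSpace.denseRange_denseSeq X).equalizer (by fun_prop) (by fun_prop) ?_
    ext n
    simp [← h1 n, h2 n]
  have hTm : AEStronglyMeasurable T (normHaar G) :=
    aestronglyMeasurable_compactOperators (fun ω => hc (T ω))
      (fun x => (hf x).aestronglyMeasurable.congr (EventuallyEq.symm (hT x)))
      fun φ => (hg φ).aestronglyMeasurable.congr (hTg φ).symm
  have hTi : Integrable T (normHaar G) :=
    ⟨hTm, (lintegral_mono_ae hTb).trans_lt hhfin⟩
  have hFi : Integrable (fun ω => e.symm (T ω)) (normHaar G) :=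
    (e.symm.toLinearIsometry.toContinuousLinearMap).integrable_comp hTi
  refine ⟨fun ω => e.symm (T ω), hFi, ?_⟩
  ext s hs
  rw [withDensityᵥ_apply hFi hs]
  refine Eq.trans ?_ ((e.symm.toLinearIsometry.toContinuousLinearMap).integral_comp_comm
    hTi.integrableOn).symm
  change μ s = e.symm (∫ ω in s, T ω ∂(normHaar G))
  rw [LinearIsometryEquiv.eq_symm_apply]
  ext x
  rw [← hfs x s hs, ContinuousLinearMap.integral_apply hTi.integrableOn]
  exact integral_congr_ae (ae_restrict_of_ae ((hT x).mono fun _ h => h.symm))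

/-- The type II-`Λ`-Radon-Nikodym property lifts to spaces of compact operators. -/
lemma TypeIIRNP.of_operators [TopologicalSpace.SeparableSpace X]
    (hc : ∀ T : X →L[ℂ] Y, IsCompactOperator T) (e : E ≃ₗᵢ[ℂ] (X →L[ℂ] Y))
    {Λ : Set (PontryaginDual G)} (hX : TypeIIRNP (StrongDual ℂ X) Λ) (hY : TypeIIRNP Y Λ) :
    TypeIIRNP E Λ := by
  refine (LSpec_one_subset Λ).antisymm' fun μ hμ => ?_
  obtain ⟨F, hF, rfl⟩ := exists_density_of_operator_valued hc e hμ
    (fun L => by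
      obtain ⟨f, hf, -, h⟩ := hY.subset (clmMap_mem_MSpecAC hμ L)
      exact ⟨f, memLp_one_iff_integrable.1 hf, h⟩)
    (fun L => by
      obtain ⟨f, hf, -, h⟩ := hX.subset (clmMap_mem_MSpecAC hμ L)
      exact ⟨f, memLp_one_iff_integrable.1 hf, h⟩)
  refine ⟨F, memLp_one_iff_integrable.2 hF, fun γ hγ => ?_, rfl⟩
  rw [← fourierMeas_withDensityᵥ hF, hμ.1.2 γ hγ]

/-- The type I-`Λ`-Radon-Nikodym property lifts to spaces of compact operators. -/
lemma TypeIRNP.of_operators [TopologicalSpace.SeparableSpace X]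
    (hc : ∀ T : X →L[ℂ] Y, IsCompactOperator T) (e : E ≃ₗᵢ[ℂ] (X →L[ℂ] Y))
    {Λ : Set (PontryaginDual G)} (hX : TypeIRNP (StrongDual ℂ X) Λ) (hY : TypeIRNP Y Λ) :
    TypeIRNP E Λ := by
  refine (LSpec_top_subset Λ).antisymm' fun μ hμ => ?_
  obtain ⟨F, hF, rfl⟩ := exists_density_of_operator_valued hc e (MSpecInfty_subset_MSpecAC Λ hμ)
    (fun L => by
      obtain ⟨f, hf, -, h⟩ := hY.subset (clmMap_mem_MSpecInfty hμ L)
      exact ⟨f, hf.integrable le_top, h⟩)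
    (fun L => by
      obtain ⟨f, hf, -, h⟩ := hX.subset (clmMap_mem_MSpecInfty hμ L)
      exact ⟨f, hf.integrable le_top, h⟩)
  obtain ⟨C, hC⟩ := hμ.2
  refine ⟨F, memLp_top_of_bound hF.aestronglyMeasurable C ?_, fun γ hγ => ?_, rfl⟩
  · rw [Measure.variation_withDensityᵥ hF] at hC
    have h : ∀ᵐ ω ∂(normHaar G), ‖F ω‖ₑ ≤ (C : ℝ≥0∞) := by
      refine ae_le_of_withDensity_le hF.aestronglyMeasurable.enorm (hC.trans_eq ?_)
      exact (withDensity_const (C : ℝ≥0∞)).symm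
    filter_upwards [h] with ω hω
    rw [enorm_eq_nnnorm] at hω
    exact_mod_cast hω
  · rw [← fourierMeas_withDensityᵥ hF, hμ.1.2 γ hγ]

end RadonNikodym

/-! ### Radial limits of Poisson integrals -/

section Poisson

/-- Dyadic domination of the Cauchy kernel by multiples of indicators of balls. -/
lemma ofReal_cauchyKernel_le_tsum {a : ℝ} (ha : 0 < a) (θ s : ℝ) :
    ENNReal.ofReal (a / (a ^ 2 + (s - θ) ^ 2)) ≤ ∑' k : ℕ,
      (Metric.closedBall θ (2 ^ k * a)).indicator
        (fun _ => ENNReal.ofReal (4 * (1 / 4) ^ k / a)) s := by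
  classical
  have hex : ∃ k : ℕ, |s - θ| ≤ 2 ^ k * a := by
    obtain ⟨k, hk⟩ := pow_unbounded_of_one_lt (|s - θ| / a) (one_lt_two)
    exact ⟨k, ((div_lt_iff₀ ha).1 hk).le⟩
  -- the smallest ball which contains `s` is enough
  obtain ⟨k, hk, hmin⟩ : ∃ k : ℕ, |s - θ| ≤ 2 ^ k * a ∧ ∀ j < k, ¬ |s - θ| ≤ 2 ^ j * a :=
    ⟨Nat.find hex, Nat.find_spec hex, fun j hj => Nat.find_min hex hj⟩
  refine le_trans ?_ (ENNReal.le_tsum k)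
  rw [Set.indicator_of_mem (by rwa [Metric.mem_closedBall, Real.dist_eq])]
  refine ENNReal.ofReal_le_ofReal ?_
  rw [div_le_div_iff₀ (by positivity) ha]
  rcases k with _ | k
  · nlinarith [sq_nonneg (s - θ), sq_nonneg a]
  · have h1 : 2 ^ k * a ≤ |s - θ| := (not_le.1 (hmin k k.lt_succ_self)).le
    have h2 : (2 ^ k * a) ^ 2 ≤ (s - θ) ^ 2 := by
      rw [← sq_abs (s - θ)]
      gcongr
    have h3 : (4 * (1 / 4 : ℝ) ^ (k + 1)) * (2 ^ k * a) ^ 2 = a ^ 2 := by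
      have h4 : (1 / 4 : ℝ) ^ k * (2 ^ k) ^ 2 = 1 := by
        rw [← pow_mul, mul_comm k 2, pow_mul, ← mul_pow]; norm_num
      calc _ = ((1 / 4 : ℝ) ^ k * (2 ^ k) ^ 2) * a ^ 2 := by ring
        _ = _ := by rw [h4, one_mul]
    calc a * a = (4 * (1 / 4 : ℝ) ^ (k + 1)) * (2 ^ k * a) ^ 2 := by rw [h3]; ring
      _ ≤ (4 * (1 / 4 : ℝ) ^ (k + 1)) * (a ^ 2 + (s - θ) ^ 2) := by
        gcongr
        nlinarith [sq_nonneg a]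

lemma continuous_cauchyKernel {a : ℝ} (ha : 0 < a) (θ : ℝ) :
    Continuous fun s : ℝ => a / (a ^ 2 + (s - θ) ^ 2) :=
  continuous_const.div (by fun_prop) fun s => by positivity

lemma integrable_cauchyKernel {a : ℝ} (ha : 0 < a) (θ : ℝ) :
    Integrable fun s : ℝ => a / (a ^ 2 + (s - θ) ^ 2) := by
  have h := ((integrable_inv_one_add_sq.comp_div ha.ne').comp_sub_right θ).const_mul a⁻¹
  refine h.congr (.of_forall fun s => ?_)
  have : 0 < a ^ 2 + (s - θ) ^ 2 := by positivity
  have : 0 < 1 + ((s - θ) / a) ^ 2 := by positivity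
  simp only
  field_simp

/-- Cauchy means of a bounded nonnegative function tend to zero wherever its averages over balls
do. -/
lemma tendsto_cauchyMean {w : ℝ → ℝ} {M θ : ℝ} (hw : AEStronglyMeasurable w) (hw0 : ∀ s, 0 ≤ w s)
    (hwM : ∀ s, w s ≤ M)
    (hθ : Tendsto (fun δ => ⨍ s in Metric.closedBall θ δ, w s) (𝓝[>] 0) (𝓝 0)) :
    Tendsto (fun a => ∫ s, a / (a ^ 2 + (s - θ) ^ 2) * w s) (𝓝[>] 0) (𝓝 0) := by
  set A : ℝ → ℝ := fun δ => ⨍ s in Metric.closedBall θ δ, w s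
  have hM : 0 ≤ M := (hw0 θ).trans (hwM θ)
  have hvol : ∀ {δ : ℝ}, 0 ≤ δ → volume.real (Metric.closedBall θ δ) = 2 * δ := fun h => by
    rw [Measure.real, Real.volume_closedBall, ENNReal.toReal_ofReal (by positivity)]
  have hint : ∀ δ, IntegrableOn w (Metric.closedBall θ δ) := fun δ =>
    Measure.integrableOn_of_bounded (M := M) measure_closedBall_lt_top.ne hw
      (.of_forall fun s => by rw [Real.norm_of_nonneg (hw0 s)]; exact hwM s)
  have hA0 : ∀ δ, 0 ≤ A δ := fun δ => by
    simp only [A, setAverage_eq]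
    exact smul_nonneg (by positivity) (integral_nonneg hw0)
  have hAint : ∀ {δ : ℝ}, 0 < δ → ∫ s in Metric.closedBall θ δ, w s = 2 * δ * A δ := fun {δ} h => by
    simp only [A, setAverage_eq, smul_eq_mul, hvol h.le]
    field_simp
  have hAM : ∀ {δ : ℝ}, 0 < δ → A δ ≤ M := fun {δ} h => by
    have h1 : ∫ s in Metric.closedBall θ δ, w s ≤ ∫ s in Metric.closedBall θ δ, M :=
      setIntegral_mono (hint δ) (integrableOn_const measure_closedBall_lt_top.ne) hwM
    rw [hAint h, setIntegral_const, hvol h.le, smul_eq_mul] at h1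
    exact le_of_mul_le_mul_left h1 (by positivity)
  have hsum : Summable fun k : ℕ => 8 * (1 / 2 : ℝ) ^ k * M :=
    (summable_geometric_two.mul_left 8).mul_right M
  have hnn : ∀ (a : ℝ) (k : ℕ), 0 ≤ 8 * (1 / 2 : ℝ) ^ k * A (2 ^ k * a) := fun a k => by
    have := hA0 (2 ^ k * a); positivity
  have hle : ∀ {a : ℝ}, 0 < a → ∀ k : ℕ, 8 * (1 / 2 : ℝ) ^ k * A (2 ^ k * a)
      ≤ 8 * (1 / 2) ^ k * M :=
    fun ha k => by gcongr; exact hAM (by positivity)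
  have hlim : Tendsto (fun a => ∑' k : ℕ, 8 * (1 / 2 : ℝ) ^ k * A (2 ^ k * a)) (𝓝[>] 0) (𝓝 0) := by
    have := tendsto_tsum_of_dominated_convergence (𝓕 := 𝓝[>] (0 : ℝ))
      (f := fun a (k : ℕ) => 8 * (1 / 2 : ℝ) ^ k * A (2 ^ k * a)) (g := fun _ => 0) hsum
      (fun k => ?_) ?_
    · simpa using this
    · have h1 : Tendsto (fun a : ℝ => 2 ^ k * a) (𝓝[>] 0) (𝓝[>] 0) := by
        refine tendsto_nhdsWithin_iff.2 ⟨?_, ?_⟩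
        · have : Tendsto (fun a : ℝ => 2 ^ k * a) (𝓝 0) (𝓝 (2 ^ k * 0)) :=
            (continuous_const_mul _).tendsto _
          rw [mul_zero] at this
          exact this.mono_left nhdsWithin_le_nhds
        · filter_upwards [self_mem_nhdsWithin] with a (ha : 0 < a)
          exact Set.mem_Ioi.2 (by positivity)
      simpa using (hθ.comp h1).const_mul (8 * (1 / 2 : ℝ) ^ k)
    · filter_upwards [self_mem_nhdsWithin] with a (ha : 0 < a) k
      rw [Real.norm_of_nonneg (hnn a k)]
      exact hle ha k
  refine squeeze_zero' ?_ ?_ hlim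
  · filter_upwards [self_mem_nhdsWithin] with a (ha : 0 < a)
    exact integral_nonneg fun s => by have := hw0 s; positivity
  · filter_upwards [self_mem_nhdsWithin] with a (ha : 0 < a)
    have hsa : Summable fun k : ℕ => 8 * (1 / 2 : ℝ) ^ k * A (2 ^ k * a) :=
      hsum.of_nonneg_of_le (hnn a) (hle ha)
    rw [integral_eq_lintegral_of_nonneg_ae (.of_forall fun s => by have := hw0 s; positivity)
      (by exact (continuous_cauchyKernel ha θ).aestronglyMeasurable.mul hw)]
    refine ENNReal.toReal_le_of_le_ofReal (tsum_nonneg (hnn a)) ?_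
    rw [ENNReal.ofReal_tsum_of_nonneg (hnn a) hsa]
    calc ∫⁻ s, ENNReal.ofReal (a / (a ^ 2 + (s - θ) ^ 2) * w s)
        ≤ ∫⁻ s, ∑' k : ℕ, (Metric.closedBall θ (2 ^ k * a)).indicator
            (fun s => ENNReal.ofReal (4 * (1 / 4) ^ k / a) * ENNReal.ofReal (w s)) s := by
          refine lintegral_mono fun s => ?_
          rw [ENNReal.ofReal_mul (by positivity)]
          refine (mul_le_mul_left (ofReal_cauchyKernel_le_tsum ha θ s) _).trans ?_
          rw [← ENNReal.tsum_mul_right]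
          refine ENNReal.tsum_le_tsum fun k => le_of_eq ?_
          by_cases hs : s ∈ Metric.closedBall θ (2 ^ k * a)
          · rw [Set.indicator_of_mem hs, Set.indicator_of_mem hs]
          · rw [Set.indicator_of_notMem hs, Set.indicator_of_notMem hs, zero_mul]
      _ = ∑' k : ℕ, ENNReal.ofReal (8 * (1 / 2) ^ k * A (2 ^ k * a)) := by
          rw [lintegral_tsum fun k => ?_]
          · refine tsum_congr fun k => ?_
            have hpos : 0 < 2 ^ k * a := by positivity
            rw [lintegral_indicator measurableSet_closedBall, lintegral_const_mul' _ _
              ENNReal.ofReal_ne_top, ← ofReal_integral_eq_lintegral_ofReal (hint _)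
              (.of_forall hw0), ← ENNReal.ofReal_mul (by positivity), hAint hpos]
            congr 1
            have h4 : (1 / 4 : ℝ) ^ k * 2 ^ k = (1 / 2) ^ k := by rw [← mul_pow]; norm_num
            rw [← h4]
            field_simp
            ring
          · exact ((hw.aemeasurable.ennreal_ofReal.const_mul _).indicator measurableSet_closedBall)

/-- Comparison of the Poisson and Cauchy kernels. -/
lemma poissonKernel_le_cauchyKernel {r θ s : ℝ} (hr : 1 / 2 ≤ r) (hr1 : r < 1)
    (hs : |s - θ| ≤ Real.pi) :
    poissonKernel 0 (r * Complex.exp (θ * Complex.I)) (circleMap 0 1 s)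
      ≤ 10 * ((1 - r) / ((1 - r) ^ 2 + (s - θ) ^ 2)) := by
  have hpi : (0 : ℝ) < Real.pi := Real.pi_pos
  have hn : ‖circleMap 0 1 s - r * Complex.exp (θ * Complex.I)‖ ^ 2
      = (1 - r) ^ 2 + 2 * r * (1 - Real.cos (s - θ)) := by
    rw [← Complex.normSq_eq_norm_sq, Complex.normSq_apply]
    simp [circleMap, Complex.exp_re, Complex.exp_im, Real.cos_sub]
    nlinarith [Real.sin_sq_add_cos_sq s, Real.sin_sq_add_cos_sq θ]
  have hz : ‖(r : ℂ) * Complex.exp (θ * Complex.I)‖ = r := by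
    rw [norm_mul, Complex.norm_exp_ofReal_mul_I, mul_one, Complex.norm_real,
      Real.norm_of_nonneg (by linarith)]
  rw [poissonKernel_def, sub_zero, sub_zero, norm_circleMap_zero, hz, hn, abs_one]
  have hcos := Real.cos_le_one_sub_mul_cos_sq hs
  have hpi2 : 1 / 5 ≤ 2 / Real.pi ^ 2 := by
    rw [div_le_div_iff₀ (by norm_num) (by positivity)]
    nlinarith [Real.pi_lt_d2]
  have hlow : 1 / 5 * (s - θ) ^ 2 ≤ 2 * r * (1 - Real.cos (s - θ)) := by
    have h1 : 1 / 5 * (s - θ) ^ 2 ≤ 1 - Real.cos (s - θ) := by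
      nlinarith [sq_nonneg (s - θ)]
    have h2 : 0 ≤ 1 - Real.cos (s - θ) := by linarith [Real.cos_le_one (s - θ)]
    nlinarith
  have hpos : 0 < (1 - r) ^ 2 := by have : 0 < 1 - r := by linarith
                                    positivity
  rw [mul_div_assoc', div_le_div_iff₀ (by nlinarith [sq_nonneg (s - θ)])
    (by nlinarith [sq_nonneg (s - θ)])]
  have h1 : 1 ^ 2 - r ^ 2 ≤ 2 * (1 - r) := by nlinarith
  have h3 : (1 - r) ^ 2 + (s - θ) ^ 2 ≤ 5 * ((1 - r) ^ 2 + 2 * r * (1 - Real.cos (s - θ))) := by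
    linarith
  calc (1 ^ 2 - r ^ 2) * ((1 - r) ^ 2 + (s - θ) ^ 2)
      ≤ 2 * (1 - r) * ((1 - r) ^ 2 + (s - θ) ^ 2) := by gcongr
    _ ≤ 2 * (1 - r) * (5 * ((1 - r) ^ 2 + 2 * r * (1 - Real.cos (s - θ)))) := by
        gcongr
    _ = _ := by ring

variable {E : Type*} [NormedAddCommGroup E] [NormedSpace ℂ E] [CompleteSpace E]

lemma continuous_poissonKernel_circleMap {z : ℂ} (hz : z ∈ Metric.ball (0 : ℂ) 1) :
    Continuous fun s : ℝ => poissonKernel 0 z (circleMap 0 1 s) := by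
  simp only [poissonKernel_def, sub_zero]
  refine Continuous.div (by fun_prop) (by fun_prop) fun s => ?_
  have : circleMap 0 1 s - z ≠ 0 := sub_ne_zero.2 (circleMap_ne_mem_ball hz s)
  positivity

lemma poissonKernel_circleMap_nonneg {z : ℂ} (hz : z ∈ Metric.ball (0 : ℂ) 1) (s : ℝ) :
    0 ≤ poissonKernel 0 z (circleMap 0 1 s) := by
  rw [mem_ball_zero_iff] at hz
  rw [poissonKernel_def, sub_zero, sub_zero, norm_circleMap_zero, abs_one]
  have := norm_nonneg z
  refine div_nonneg ?_ (by positivity)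
  nlinarith

lemma circleAverage_poissonKernel {z : ℂ} (hz : z ∈ Metric.ball (0 : ℂ) 1) (c : E) :
    Real.circleAverage (fun ζ => poissonKernel 0 z ζ • c) 0 1 = c :=
  DiffContOnCl.circleAverage_poissonKernel_smul (f := fun _ => c) diffContOnCl_const hz

omit [CompleteSpace E] in
lemma circleIntegrable_poissonKernel_smul {B : ℂ → E}
    (hB : AEStronglyMeasurable fun s : ℝ => B (circleMap 0 1 s)) {C : ℝ} (hC : ∀ ζ, ‖B ζ‖ ≤ C)
    {z : ℂ} (hz : z ∈ Metric.ball (0 : ℂ) 1) :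
    CircleIntegrable (fun ζ => poissonKernel 0 z ζ • B ζ) 0 1 := by
  have hBi : IntervalIntegrable (fun s : ℝ => B (circleMap 0 1 s)) volume 0 (2 * Real.pi) := by
    rw [intervalIntegrable_iff]
    exact Measure.integrableOn_of_bounded (M := C) (by simp [Set.uIoc]) hB
      (.of_forall fun s => hC _)
  exact hBi.continuousOn_smul (continuous_poissonKernel_circleMap hz).continuousOn

/-- Fatou's theorem: the Poisson integral of a bounded, strongly measurable function on the circle
converges radially to this function almost everywhere, namely at its Lebesgue points. -/
lemma ae_tendsto_poissonIntegral {B : ℂ → E}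
    (hB : AEStronglyMeasurable fun s : ℝ => B (circleMap 0 1 s)) {C : ℝ} (hC : ∀ ζ, ‖B ζ‖ ≤ C) :
    ∀ᵐ θ : ℝ, Tendsto (fun r : ℝ => Real.circleAverage (fun ζ =>
      poissonKernel 0 (r * Complex.exp (θ * Complex.I)) ζ • B ζ) 0 1) (𝓝[<] 1)
      (𝓝 (B (circleMap 0 1 θ))) := by
  have hloc : LocallyIntegrable fun s : ℝ => B (circleMap 0 1 s) := by
    have : MemLp (fun s : ℝ => B (circleMap 0 1 s)) ∞ :=
      memLp_top_of_bound hB C (.of_forall fun s => hC _)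
    exact this.locallyIntegrable le_top
  filter_upwards [IsUnifLocDoublingMeasure.ae_tendsto_average_norm_sub volume hloc 1] with θ hθ
  set b := B (circleMap 0 1 θ)
  let w : ℝ → ℝ := fun s => ‖B (circleMap 0 1 s) - b‖
  have hw : AEStronglyMeasurable w := (hB.sub aestronglyMeasurable_const).norm
  have hwM : ∀ s, w s ≤ C + C := fun s => (norm_sub_le _ _).trans (add_le_add (hC _) (hC _))
  have hmean := tendsto_cauchyMean hw (fun s => norm_nonneg _) hwM
    (hθ (l := 𝓝[>] 0) (fun _ => θ) id tendsto_id (by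
      filter_upwards [self_mem_nhdsWithin] with δ (hδ : 0 < δ)
      simpa using hδ.le))
  have hsub : Tendsto (fun r : ℝ => 1 - r) (𝓝[<] 1) (𝓝[>] 0) := by
    refine tendsto_nhdsWithin_iff.2 ⟨?_, ?_⟩
    · have : Tendsto (fun r : ℝ => 1 - r) (𝓝 1) (𝓝 (1 - 1)) := (continuous_sub_left 1).tendsto 1
      rw [sub_self] at this
      exact this.mono_left nhdsWithin_le_nhds
    · filter_upwards [self_mem_nhdsWithin] with r (hr : r < 1)
      exact Set.mem_Ioi.2 (by linarith)
  rw [tendsto_iff_norm_sub_tendsto_zero]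
  have hlim := (hmean.comp hsub).const_mul ((2 * Real.pi)⁻¹ * 10)
  rw [mul_zero] at hlim
  refine squeeze_zero' (.of_forall fun r => norm_nonneg _) ?_ hlim
  filter_upwards [self_mem_nhdsWithin, nhdsWithin_le_nhds (Ici_mem_nhds
    (show (1 / 2 : ℝ) < 1 by norm_num))] with r (hr1 : r < 1) (hr : 1 / 2 ≤ r)
  set z : ℂ := r * Complex.exp (θ * Complex.I)
  have hz : z ∈ Metric.ball (0 : ℂ) 1 := by
    rw [mem_ball_zero_iff, norm_mul, Complex.norm_exp_ofReal_mul_I, mul_one, Complex.norm_real,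
      Real.norm_of_nonneg (by linarith)]
    exact hr1
  have hwint : Integrable fun s => (1 - r) / ((1 - r) ^ 2 + (s - θ) ^ 2) * w s := by
    refine (integrable_cauchyKernel (sub_pos.2 hr1) θ).mul_bdd (c := C + C) hw
      (.of_forall fun s => ?_)
    rw [Real.norm_of_nonneg (norm_nonneg _)]
    exact hwM s
  have h1 : Real.circleAverage (fun ζ => poissonKernel 0 z ζ • B ζ) 0 1 - b
      = Real.circleAverage (fun ζ => poissonKernel 0 z ζ • (B ζ - b)) 0 1 := by
    nth_rw 1 [← circleAverage_poissonKernel hz b]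
    rw [← Real.circleAverage_fun_sub (circleIntegrable_poissonKernel_smul hB hC hz)
      (circleIntegrable_poissonKernel_smul aestronglyMeasurable_const (fun _ => hC _) hz)]
    simp only [smul_sub, b]
  let F : ℝ → E := fun s => poissonKernel 0 z (circleMap 0 1 s) • (B (circleMap 0 1 s) - b)
  have hper : Function.Periodic F (2 * Real.pi) := fun s => by
    simp only [F, periodic_circleMap 0 1 s]
  rw [h1, Real.circleAverage_def]
  have h2 : ∫ s in (0 : ℝ)..2 * Real.pi, F s = ∫ s in (θ - Real.pi)..(θ + Real.pi), F s := by
    have := hper.intervalIntegral_add_eq 0 (θ - Real.pi)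
    rw [zero_add] at this
    rw [this]
    congr 1
    ring
  change ‖(2 * Real.pi)⁻¹ • ∫ s in (0 : ℝ)..2 * Real.pi, F s‖ ≤ _
  rw [h2, norm_smul, Real.norm_of_nonneg (by positivity), mul_assoc]
  refine mul_le_mul_of_nonneg_left ?_ (by positivity)
  have hpi := Real.pi_pos
  refine (intervalIntegral.norm_integral_le_of_norm_le (by linarith)
    (g := fun s => 10 * ((1 - r) / ((1 - r) ^ 2 + (s - θ) ^ 2) * w s)) (.of_forall fun s hs => ?_)
    (hwint.const_mul 10).intervalIntegrable).trans ?_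
  · simp only [F]
    rw [norm_smul, Real.norm_of_nonneg (poissonKernel_circleMap_nonneg hz s), ← mul_assoc]
    refine mul_le_mul_of_nonneg_right (poissonKernel_le_cauchyKernel hr hr1 ?_) (norm_nonneg _)
    rw [abs_le]
    constructor <;> linarith [hs.1, hs.2]
  · rw [intervalIntegral.integral_of_le (by linarith), Function.comp_apply, ← integral_const_mul]
    refine setIntegral_le_integral (hwint.const_mul 10) (.of_forall fun s => ?_)
    have : 0 < 1 - r := by linarith
    have := norm_nonneg (B (circleMap 0 1 s) - b)
    simp only [w, Pi.zero_apply]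
    positivity

end Poisson

/-! ### The analytic Radon-Nikodym property -/

section AnalyticRadonNikodym

variable {X : Type*} [NormedAddCommGroup X] [NormedSpace ℂ X] [CompleteSpace X]
  {Y : Type*} [NormedAddCommGroup Y] [NormedSpace ℂ Y] [CompleteSpace Y]
  {E : Type*} [NormedAddCommGroup E] [NormedSpace ℂ E] [CompleteSpace E]

/-- A bounded sequence of operators converging on a dense sequence converges strongly. -/
lemma exists_strong_limit {T : ℕ → X →L[ℂ] Y} {C : ℝ} (hT : ∀ n, ‖T n‖ ≤ C) {d : ℕ → X}
    (hd : DenseRange d) (h : ∀ k, ∃ y, Tendsto (fun n => T n (d k)) atTop (𝓝 y)) :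
    ∃ S : X →L[ℂ] Y, (∀ x, Tendsto (fun n => T n x) atTop (𝓝 (S x))) ∧ ‖S‖ ≤ C := by
  have hC : 0 ≤ C := (norm_nonneg _).trans (hT 0)
  have hex : ∀ x, ∃ y, Tendsto (fun n => T n x) atTop (𝓝 y) := by
    intro x
    refine cauchySeq_tendsto_of_complete (Metric.cauchySeq_iff'.2 fun ε hε => ?_)
    obtain ⟨k, hk⟩ := hd.exists_dist_lt x (show 0 < ε / (4 * (C + 1)) by positivity)
    obtain ⟨y, hy⟩ := h k
    obtain ⟨N, hN⟩ := Metric.cauchySeq_iff'.1 hy.cauchySeq (ε / 4) (by positivity)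
    have hlt : ∀ n, dist (T n x) (T n (d k)) ≤ ε / 4 := fun n => by
      rw [dist_eq_norm, ← map_sub]
      rw [dist_eq_norm] at hk
      calc ‖T n (x - d k)‖ ≤ C * ‖x - d k‖ := (T n).le_of_opNorm_le (hT n) _
        _ ≤ (C + 1) * (ε / (4 * (C + 1))) := by gcongr; linarith
        _ = ε / 4 := by field_simp
    refine ⟨N, fun n hn => ?_⟩
    have h1 := dist_triangle4 (T n x) (T n (d k)) (T N (d k)) (T N x)
    have h2 := hlt N
    rw [dist_comm] at h2
    linarith [hN n hn, hlt n]
  choose S hS using hex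
  let S' : X →L[ℂ] Y := continuousLinearMapOfTendsto T (tendsto_pi_nhds.2 hS)
  exact ⟨S', hS, S'.opNorm_le_bound hC fun x =>
    le_of_tendsto (hS x).norm (.of_forall fun n => (T n).le_of_opNorm_le (hT n) x)⟩

/-- Radii increasing to `1`. -/
noncomputable def radius (n : ℕ) : ℝ := 1 - 1 / ((n : ℝ) + 1)

lemma radius_nonneg (n : ℕ) : 0 ≤ radius n := by
  rw [radius, sub_nonneg, div_le_one (by positivity)]
  simp

lemma radius_lt_one (n : ℕ) : radius n < 1 := by
  rw [radius, sub_lt_self_iff]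
  positivity

lemma tendsto_radius : Tendsto radius atTop (𝓝[<] 1) := by
  refine tendsto_nhdsWithin_iff.2 ⟨?_, .of_forall radius_lt_one⟩
  have h := (tendsto_const_nhds (x := (1 : ℝ))).sub
    (tendsto_one_div_add_atTop_nhds_zero_nat (𝕜 := ℝ))
  rw [sub_zero] at h
  exact h

lemma radius_smul_mem_ball (n : ℕ) {z : ℂ} (hz : ‖z‖ ≤ 1) :
    (radius n : ℂ) * z ∈ Metric.ball (0 : ℂ) 1 := by
  rw [mem_ball_zero_iff, norm_mul, Complex.norm_real, Real.norm_of_nonneg (radius_nonneg n)]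
  exact (mul_le_of_le_one_right (radius_nonneg n) hz).trans_lt (radius_lt_one n)

/-- Bounded linear images in a space with the analytic Radon-Nikodym property of a bounded analytic
function have radial limits. -/
lemma AnalyticRNP.ae_exists_limit_radius {W F : Type*} [NormedAddCommGroup W] [NormedSpace ℂ W]
    [NormedAddCommGroup F] [NormedSpace ℂ F] [CompleteSpace F] (hF : AnalyticRNP F) {g : ℂ → W}
    (hg : DifferentiableOn ℂ g (Metric.ball 0 1)) {C : ℝ}
    (hgC : ∀ z ∈ Metric.ball (0 : ℂ) 1, ‖g z‖ ≤ C) (L : W →L[ℂ] F) :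
    ∀ᵐ s : ℝ, ∃ y, Tendsto (fun n => L (g (radius n * circleMap 0 1 s))) atTop (𝓝 y) := by
  have h := hF (fun z => L (g z)) (L.differentiable.comp_differentiableOn hg)
    ⟨‖L‖ * C, fun z hz => L.le_opNorm_of_le (hgC z hz)⟩
  filter_upwards [h] with s ⟨y, hy⟩
  refine ⟨y, ?_⟩
  have hexp : circleMap 0 1 s = Complex.exp (s * Complex.I) := by simp [circleMap]
  rw [hexp]
  exact hy.comp tendsto_radius

omit [CompleteSpace X] in
/-- A bounded analytic operator-valued function is the Poisson integral of its boundary values,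
even if these are only attained in the strong operator topology. -/
lemma eq_poissonIntegral {g : ℂ → X →L[ℂ] Y} (hg : DifferentiableOn ℂ g (Metric.ball 0 1)) {C : ℝ}
    (hgC : ∀ z ∈ Metric.ball (0 : ℂ) 1, ‖g z‖ ≤ C) {B : ℂ → X →L[ℂ] Y} (hB : ∀ ζ, ‖B ζ‖ ≤ C)
    (hBm : AEStronglyMeasurable fun s : ℝ => B (circleMap 0 1 s))
    (hlim : ∀ᵐ s : ℝ, ∀ x, Tendsto (fun n => g (radius n * circleMap 0 1 s) x) atTop
      (𝓝 (B (circleMap 0 1 s) x))) {z : ℂ} (hz : z ∈ Metric.ball (0 : ℂ) 1) :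
    Real.circleAverage (fun ζ => poissonKernel 0 z ζ • B ζ) 0 1 = g z := by
  ext x
  have hz' : ‖z‖ ≤ 1 := (mem_ball_zero_iff.1 hz).le
  have hcircle : ∀ s : ℝ, ‖circleMap 0 1 s‖ ≤ 1 := fun s => by simp
  have hmaps : ∀ n, Set.MapsTo (fun ζ : ℂ => (radius n : ℂ) * ζ) (Metric.closedBall 0 1)
      (Metric.ball 0 1) := fun n ζ hζ => radius_smul_mem_ball n (mem_closedBall_zero_iff.1 hζ)
  have hdil : ∀ n, DifferentiableOn ℂ (fun ζ : ℂ => g (radius n * ζ) x) (Metric.closedBall 0 1) :=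
    fun n => ((hg.comp (by fun_prop) (hmaps n)).clm_apply (differentiableOn_const x))
  -- Poisson's formula for the dilated functions
  have hpois : ∀ n, Real.circleAverage (fun ζ => poissonKernel 0 z ζ • g (radius n * ζ) x) 0 1
      = g (radius n * z) x := fun n => by
    refine DiffContOnCl.circleAverage_poissonKernel_smul (f := fun ζ => g (radius n * ζ) x) ?_ hz
    refine DifferentiableOn.diffContOnCl ((hdil n).mono ?_)
    rw [closure_ball _ one_ne_zero]
  have hL : Tendsto (fun n => g (radius n * z) x) atTop (𝓝 (g z x)) := by
    have h1 : Tendsto (fun n => (radius n : ℂ) * z) atTop (𝓝 z) := by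
      have h2 := (Complex.continuous_ofReal.tendsto 1).comp
        (tendsto_radius.mono_right nhdsWithin_le_nhds)
      simpa using h2.mul_const z
    have h2 := ((hg.continuousOn.continuousAt (Metric.isOpen_ball.mem_nhds hz)).tendsto).comp h1
    exact ((ContinuousLinearMap.apply ℂ Y x).continuous.tendsto _).comp h2
  refine tendsto_nhds_unique ?_ hL
  simp_rw [← hpois, Real.circleAverage_def]
  have hcomm : ((2 * Real.pi)⁻¹ • ∫ s in (0 : ℝ)..2 * Real.pi,
        poissonKernel 0 z (circleMap 0 1 s) • B (circleMap 0 1 s)) x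
      = (2 * Real.pi)⁻¹ • ∫ s in (0 : ℝ)..2 * Real.pi,
        poissonKernel 0 z (circleMap 0 1 s) • B (circleMap 0 1 s) x := by
    rw [smul_apply, ContinuousLinearMap.intervalIntegral_apply
      (circleIntegrable_poissonKernel_smul hBm hB hz)]
    rfl
  rw [hcomm]
  refine Tendsto.const_smul ?_ _
  have hK := continuous_poissonKernel_circleMap hz
  refine intervalIntegral.tendsto_integral_filter_of_dominated_convergence
    (fun s => poissonKernel 0 z (circleMap 0 1 s) * (C * ‖x‖)) (.of_forall fun n => ?_)
    (.of_forall fun n => .of_forall fun s _ => ?_) ?_ ?_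
  · refine Continuous.aestronglyMeasurable (hK.smul ?_)
    exact (hdil n).continuousOn.comp_continuous (continuous_circleMap 0 1)
      fun s => mem_closedBall_zero_iff.2 (hcircle s)
  · rw [norm_smul, Real.norm_of_nonneg (poissonKernel_circleMap_nonneg hz s)]
    exact mul_le_mul_of_nonneg_left ((g _).le_of_opNorm_le
      (hgC _ (radius_smul_mem_ball n (hcircle s))) x) (poissonKernel_circleMap_nonneg hz s)
  · exact (hK.mul continuous_const).intervalIntegrable _ _
  · filter_upwards [hlim] with s hs _
    exact (hs x).const_smul _

/-- The analytic Radon-Nikodym property lifts to spaces of compact operators. -/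
lemma AnalyticRNP.of_operators [TopologicalSpace.SeparableSpace X]
    (hc : ∀ T : X →L[ℂ] Y, IsCompactOperator T) (e : E ≃ₗᵢ[ℂ] (X →L[ℂ] Y))
    (hX : AnalyticRNP (StrongDual ℂ X)) (hY : AnalyticRNP Y) : AnalyticRNP E := by
  rintro f hf ⟨C, hC⟩
  let g : ℂ → X →L[ℂ] Y := fun z => e (f z)
  have hg : DifferentiableOn ℂ g (Metric.ball 0 1) :=
    e.toLinearIsometry.toContinuousLinearMap.differentiable.comp_differentiableOn hf
  have hgC : ∀ z ∈ Metric.ball (0 : ℂ) 1, ‖g z‖ ≤ C := fun z hz => by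
    simpa [g] using hC z hz
  have hcircle : ∀ s : ℝ, ‖circleMap 0 1 s‖ ≤ 1 := fun s => by simp
  -- boundary values in the strong operator topology
  have hex : ∀ᵐ s : ℝ, ∃ S : X →L[ℂ] Y,
      (∀ x, Tendsto (fun n => g (radius n * circleMap 0 1 s) x) atTop (𝓝 (S x))) ∧ ‖S‖ ≤ C := by
    filter_upwards [ae_all_iff.2 fun k =>
      hY.ae_exists_limit_radius hg hgC
        (ContinuousLinearMap.apply ℂ Y (TopologicalSpace.denseSeq X k))] with s hs
    exact exists_strong_limit (fun n => hgC _ (radius_smul_mem_ball n (hcircle s)))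
      (TopologicalSpace.denseRange_denseSeq X) hs
  have hC0 : 0 ≤ C := (norm_nonneg _).trans (hgC 0 (by simp))
  obtain ⟨B, hBC, hB⟩ : ∃ B : ℂ → X →L[ℂ] Y, (∀ ζ, ‖B ζ‖ ≤ C) ∧ ∀ᵐ s : ℝ, ∀ x,
      Tendsto (fun n => g (radius n * circleMap 0 1 s) x) atTop (𝓝 (B (circleMap 0 1 s) x)) := by
    -- `0` is used at the points without strong limit, so that `B` is bounded everywhere
    have hch : ∀ ζ : ℂ, ∃ T : X →L[ℂ] Y, ‖T‖ ≤ C ∧ ∀ S : X →L[ℂ] Y,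
        (∀ x, Tendsto (fun n => g (radius n * ζ) x) atTop (𝓝 (S x))) → ‖S‖ ≤ C → T = S := by
      intro ζ
      by_cases h : ∃ S : X →L[ℂ] Y,
        (∀ x, Tendsto (fun n => g (radius n * ζ) x) atTop (𝓝 (S x))) ∧ ‖S‖ ≤ C
      · obtain ⟨S, hS, hSC⟩ := h
        exact ⟨S, hSC, fun S' hS' _ => ContinuousLinearMap.ext fun x =>
          tendsto_nhds_unique (hS x) (hS' x)⟩
      · exact ⟨0, by simpa using hC0, fun S hS hSC => absurd ⟨S, hS, hSC⟩ h⟩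
    choose B hBC hB using hch
    refine ⟨B, hBC, ?_⟩
    filter_upwards [hex] with s ⟨S, hS, hSC⟩
    rwa [hB _ S hS hSC]
  have hgcont : ∀ n, Continuous fun s : ℝ => g (radius n * circleMap 0 1 s) := fun n =>
    hg.continuousOn.comp_continuous (by fun_prop) fun s => radius_smul_mem_ball n (hcircle s)
  have hBm : AEStronglyMeasurable fun s : ℝ => B (circleMap 0 1 s) := by
    refine aestronglyMeasurable_compactOperators (fun s => hc _) (fun x => ?_) fun φ => ?_
    · refine aestronglyMeasurable_of_tendsto_ae atTop
        (f := fun n (s : ℝ) => g (radius n * circleMap 0 1 s) x)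
        (fun n => ((hgcont n).clm_apply continuous_const).aestronglyMeasurable) ?_
      filter_upwards [hB] with s hs using hs x
    · let L : (X →L[ℂ] Y) →L[ℂ] StrongDual ℂ X := ContinuousLinearMap.compL ℂ X Y ℂ φ
      refine aestronglyMeasurable_of_tendsto_ae atTop
        (f := fun n (s : ℝ) => L (g (radius n * circleMap 0 1 s)))
        (fun n => (L.continuous.comp (hgcont n)).aestronglyMeasurable) ?_
      filter_upwards [hB, hX.ae_exists_limit_radius hg hgC L] with s hs ⟨ψ, hψ⟩
      -- the norm limit agrees with the pointwise limit
      have : ψ = φ.comp (B (circleMap 0 1 s)) := by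
        ext x
        exact tendsto_nhds_unique (((ContinuousLinearMap.apply ℂ ℂ x).continuous.tendsto _).comp hψ)
          ((φ.continuous.tendsto _).comp (hs x))
      rwa [← this]
  filter_upwards [ae_tendsto_poissonIntegral hBm hBC] with θ hθ
  refine ⟨e.symm (B (circleMap 0 1 θ)), ?_⟩
  have hlim : Tendsto (fun r : ℝ => g (r * Complex.exp (θ * Complex.I))) (𝓝[<] 1)
      (𝓝 (B (circleMap 0 1 θ))) := by
    refine hθ.congr' ?_
    filter_upwards [self_mem_nhdsWithin, nhdsWithin_le_nhds (Ici_mem_nhds (zero_lt_one' ℝ))]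
      with r (hr : r < 1) (hr0 : 0 ≤ r)
    refine eq_poissonIntegral hg hgC hBC hBm hB ?_
    rwa [mem_ball_zero_iff, norm_mul, Complex.norm_exp_ofReal_mul_I, mul_one, Complex.norm_real,
      Real.norm_of_nonneg hr0]
  simpa [g, Function.comp_def] using (e.symm.continuous.tendsto _).comp hlim

end AnalyticRadonNikodym

theorem theorem3
    {G : Type*} [CommGroup G] [TopologicalSpace G] [IsTopologicalGroup G]
    [CompactSpace G] [TopologicalSpace.MetrizableSpace G] [MeasurableSpace G] [BorelSpace G]
    (Λ : Set (PontryaginDual G))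
    {X : Type*} [NormedAddCommGroup X] [NormedSpace ℂ X] [CompleteSpace X]
    {Y : Type*} [NormedAddCommGroup Y] [NormedSpace ℂ Y] [CompleteSpace Y]
    (hsep : TopologicalSpace.SeparableSpace X)
    (hLK : CompactOps X Y = ⊤) :
    (TypeIRNP (StrongDual ℂ X) Λ → TypeIRNP Y Λ → TypeIRNP (CompactOps X Y) Λ) ∧
    (TypeIIRNP (StrongDual ℂ X) Λ → TypeIIRNP Y Λ → TypeIIRNP (CompactOps X Y) Λ) ∧
    (AnalyticRNP (StrongDual ℂ X) → AnalyticRNP Y → AnalyticRNP (CompactOps X Y)) := by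
  have hmem : ∀ T : X →L[ℂ] Y, T ∈ CompactOps X Y := fun T => hLK ▸ Submodule.mem_top
  let e : CompactOps X Y ≃ₗᵢ[ℂ] (X →L[ℂ] Y) :=
    LinearIsometryEquiv.ofSurjective (CompactOps X Y).subtypeₗᵢ fun T => ⟨⟨T, hmem T⟩, rfl⟩
  exact ⟨.of_operators hmem e, .of_operators hmem e, .of_operators hmem e⟩
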